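/- All algebras are commutative real algebras and all morphisms are morphisms of real algebras; $\mathrm{Alg}_{\mathbb R}$ is their category. For an algebra $A$ put $\mathrm{Spec}_{\mathbb R}(A)=\mathrm{Hom}(A,\mathbb R)$ and, for $a\in A$, $\mathrm{ev}_a:\mathrm{Spec}_{\mathbb R}(A)\to\mathbb R$, $x\mapsto x(a)$. Call $A$ - *smoothly affine* if for every $n$ the map $\mathrm{Hom}(C^\infty(\mathbb R^n),A)\to A^n$, $\varphi\mapsto(\varphi(x_1),\dots,\varphi(x_n))$, is bijective, where $x_1,\dots,x_n$ are the coordinate functions; - *smoothly closed geometric* if for all $n$, all $a_1,\dots,a_n\in A$ and all $f\in C^\infty(\mathbb R^n)$ there is a unique $b\in A$ with $f\circ(\mathrm{ev}_{a_1}\times\dots\times\mathrm{ev}_{a_n})=\mathrm{ev}_b$ on $\mathrm{Spec}_{\mathbb R}(A)$. Let $\mathrm{Alg}_{sa}$ and $\mathrm{Alg}_{scg}$ be the corresponding full subcategories of $\mathrm{Alg}_{\mathbb R}$; the tensor products $\otimes_{sa}$ and $\otimes_{scg}$ denote the coproducts in them. Let $\mathrm{Open}_{C^\infty}$ be the category of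 open subsets of the spaces $\mathbb R^n$, $n\ge 0$, with smooth maps, and let $\tau$ be its usual topology, generated by the open coverings. Manifolds are smooth, finite-dimensional, Hausdorff, second countable and without boundary. **Theorem.** 1. Every smoothly closed geometric algebra is smoothly affine. 2. For all $p,q\ge 0$, the algebras $C^\infty(\mathbb R^p)$, $C^\infty(\mathbb R^q)$, $C^\infty(\mathbb R^{p+q})$ are smoothly affine, and the pullbacks along the two projections exhibit $C^\infty(\mathbb R^{p+q})$ as the coproduct of $C^\infty(\mathbb R^p)$ and $C^\infty(\mathbb R^q)$ in $\mathrm{Alg}_{sa}$: $C^\infty(\mathbb R^p)\otimes_{sa}C^\infty(\mathbb R^q)\cong C^\infty(\mathbb R^{p+q})$. 3. For every open subset $U\subset\mathbb R^n$, the algebra $C^\infty(U)$ is smoothly closed geometric. 4. The algebras $C^\infty(U)$, $U\in\mathrm{Open}_{C^\infty}$, are smoothly affine, and the contravariant functor $U\mapsto C^\infty(U)$ (on maps, $\varphi\mapsto(f\mapsto f\circ\varphi)$) from $\mathrm{Open}_{C^\infty}$ to $\mathrm{Alg}_{sa}$ is fully faithful. Let $\mathrm{Alg}_{C^\infty}\subset\mathrm{Alg}_{sa}$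 be its essential image, and let $\tau_{Zar}$ be the Zariski topology on $\mathrm{Alg}_{C^\infty}^{op}$, that is, the Grothendieck topology generated by the families of localizations $\{A\to A[f_i^{-1}]\}_{i}$ such that the sets $\{x : x(f_i)\neq 0\}$ cover $\mathrm{Spec}_{\mathbb R}(A)$; here $A[f^{-1}]$ denotes the localization in $\mathrm{Alg}_{C^\infty}$, i.e. $A\to A[f^{-1}]$ is universal among the morphisms of $\mathrm{Alg}_{C^\infty}$ with source $A$ that send $f$ to a unit. Then the functor induces an equivalence of sites between $(\mathrm{Open}_{C^\infty},\tau)$ and $(\mathrm{Alg}_{C^\infty}^{op},\tau_{Zar})$: it is an equivalence of categories under which the covering sieves correspond to each other. 5. For every manifold $X$, the algebra $C^\infty(X)$ is smoothly closed geometric. 6. For all manifolds $M$ and $N$, the algebras $C^\infty(M)$, $C^\infty(N)$, $C^\infty(M\times N)$ are smoothly closed geometric, and the pullbacks along the two projections exhibit $C^\infty(M\times N)$ as the coproduct of $C^\infty(M)$ and $C^\infty(N)$ in $\mathrm{Alg}_{scg}$: $C^\infty(M)\otimes_{scg}C^\infty(N)\cong C^\infty(M\times N)$. 7. The forgetful functor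 $\mathrm{Alg}_{scg}\to\mathrm{Alg}_{\mathbb R}$ has a left adjoint $A\mapsto\overline{A}^{scg}$ (the smooth geometric closure). -/

import Mathlib

open CategoryTheory CategoryTheory.Limits TopologicalSpace Opposite
open scoped Manifold ContDiff

universe u v w

noncomputable section

namespace SmoothAlgebra

/-! ### Algebras of smooth functions -/

/-- The space `ℝⁿ`. -/
abbrev Euc (n : ℕ) : Type := EuclideanSpace ℝ (Fin n)

/-- The real algebra `C^∞(M)` of smooth real valued functions on `M` (with model `I`). -/
abbrev Cinf {E : Type*} [NormedAddCommGroup E] [NormedSpace ℝ E] {H : Type*} [TopologicalSpace H]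
    (I : ModelWithCorners ℝ E H) (M : Type u) [TopologicalSpace M] [ChartedSpace H M] : Type u :=
  C^∞⟮I, M; 𝓘(ℝ, ℝ), ℝ⟯

/-- The algebra `C^∞(ℝⁿ)`. -/
abbrev CinfEuc (n : ℕ) : Type := Cinf (𝓡 n) (Euc n)

/-- The coordinate function `x_i` on `ℝⁿ`. -/
def coord (n : ℕ) (i : Fin n) : CinfEuc n :=
  ⟨fun x => x i, (by fun_prop : ContDiff ℝ ∞ fun x : Euc n => x i).contMDiff⟩

/-- The morphism of algebras `C^∞(N) → C^∞(M)`, `f ↦ f ∘ φ`, induced by a smooth map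
`φ : M → N`. -/
def pullback {E E' : Type*} [NormedAddCommGroup E] [NormedSpace ℝ E]
    [NormedAddCommGroup E'] [NormedSpace ℝ E'] {H H' : Type*} [TopologicalSpace H]
    [TopologicalSpace H'] {I : ModelWithCorners ℝ E H} {J : ModelWithCorners ℝ E' H'}
    {M : Type u} [TopologicalSpace M] [ChartedSpace H M]
    {N : Type v} [TopologicalSpace N] [ChartedSpace H' N]
    (φ : C^∞⟮I, M; J, N⟯) : Cinf J N →ₐ[ℝ] Cinf I M where
  toFun f := f.comp φ
  map_one' := rfl
  map_mul' _ _ := rfl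
  map_zero' := rfl
  map_add' _ _ := rfl
  commutes' _ := rfl

/-- The projection of `ℝ^{p+q}` on the first `p` coordinates. -/
def projLeft (p q : ℕ) : C^∞⟮𝓡 (p + q), Euc (p + q); 𝓡 p, Euc p⟯ :=
  ⟨fun x => WithLp.toLp 2 fun i => x (Fin.castAdd q i),
    (by fun_prop : ContDiff ℝ ∞ fun x : Euc (p + q) =>
      (WithLp.toLp 2 fun i => x (Fin.castAdd q i) : Euc p)).contMDiff⟩

/-- The projection of `ℝ^{p+q}` on the last `q` coordinates. -/
def projRight (p q : ℕ) : C^∞⟮𝓡 (p + q), Euc (p + q); 𝓡 q, Euc q⟯ :=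
  ⟨fun x => WithLp.toLp 2 fun i => x (Fin.natAdd p i),
    (by fun_prop : ContDiff ℝ ∞ fun x : Euc (p + q) =>
      (WithLp.toLp 2 fun i => x (Fin.natAdd p i) : Euc q)).contMDiff⟩

/-! ### Smoothly affine and smoothly closed geometric algebras -/

/-- The real spectrum `Spec_ℝ(A) = Hom(A, ℝ)`. -/
abbrev RealSpec (A : Type u) [CommRing A] [Algebra ℝ A] : Type u := A →ₐ[ℝ] ℝ

/-- The function `ev_a` on `Spec_ℝ(A)`. -/
def ev {A : Type u} [CommRing A] [Algebra ℝ A] (a : A) : RealSpec A → ℝ := fun x => x a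

/-- `A` is smoothly affine: `Hom(C^∞(ℝⁿ), A) → Aⁿ`, `φ ↦ (φ(x₁), …, φ(xₙ))`, is bijective
for every `n`. -/
def IsSmoothlyAffine (A : Type u) [CommRing A] [Algebra ℝ A] : Prop :=
  ∀ n : ℕ, Function.Bijective
    fun (φ : CinfEuc n →ₐ[ℝ] A) (i : Fin n) => φ (coord n i)

/-- `A` is smoothly closed geometric: for all `a₁, …, aₙ ∈ A` and `f ∈ C^∞(ℝⁿ)` there is a unique
`b ∈ A` with `f ∘ (ev_{a₁} × ⋯ × ev_{aₙ}) = ev_b`. -/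
def IsSmoothlyClosedGeometric (A : Type u) [CommRing A] [Algebra ℝ A] : Prop :=
  ∀ (n : ℕ) (a : Fin n → A) (f : CinfEuc n),
    ∃! b : A, (fun x : RealSpec A => f (WithLp.toLp 2 fun i => ev (a i) x)) = ev b

/-- Smoothly affine algebras among commutative real algebras. -/
def smoothlyAffine : ObjectProperty (CommAlgCat.{u} ℝ) := fun A => IsSmoothlyAffine A

/-- Smoothly closed geometric algebras among commutative real algebras. -/
def smoothlyClosedGeometric : ObjectProperty (CommAlgCat.{u} ℝ) :=
  fun A => IsSmoothlyClosedGeometric A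

/-- The category `Alg_sa` (with all algebra morphisms). -/
abbrev AlgSA : Type (u + 1) := smoothlyAffine.{u}.FullSubcategory

/-- The category `Alg_scg` (with all algebra morphisms). -/
abbrev AlgSCG : Type (u + 1) := smoothlyClosedGeometric.{u}.FullSubcategory

/-! ### The category of open subsets of the spaces `ℝⁿ` -/

/-- An object of `Open_{C^∞}`: an open subset of `ℝⁿ` for some `n`. -/
structure OpenCinf : Type where
  /-- the dimension `n` -/
  dim : ℕ
  /-- the open subset of `ℝⁿ` -/
  carrier : Opens (Euc dim)

/-- Morphisms in `Open_{C^∞}` are the smooth maps. -/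
instance : Category.{0} OpenCinf where
  Hom U V := C^∞⟮𝓡 U.dim, U.carrier; 𝓡 V.dim, V.carrier⟯
  id _ := ContMDiffMap.id
  comp φ ψ := ContMDiffMap.comp ψ φ

/-- The inclusion of open subsets of `ℝⁿ`. -/
def OpenCinf.incl {n : ℕ} {V U : Opens (Euc n)} (h : V ≤ U) :
    (OpenCinf.mk n V) ⟶ (OpenCinf.mk n U) :=
  (⟨Opens.inclusion h, contMDiff_inclusion h⟩ : C^∞⟮𝓡 n, V; 𝓡 n, U⟯)

/-- The families of inclusions of open coverings `U = ⋃ V_i`. -/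
def openCovers : Precoverage OpenCinf where
  coverings U := {R | ∃ (ι : Type) (V : ι → Opens (Euc U.dim)) (h : ∀ i, V i ≤ U.carrier),
    U.carrier ≤ ⨆ i, V i ∧
    R = Presieve.ofArrows (fun i => OpenCinf.mk U.dim (V i)) (fun i => OpenCinf.incl (h i))}

/-- The usual topology `τ` on `Open_{C^∞}`: generated by the open coverings. -/
def openTopology : GrothendieckTopology OpenCinf := openCovers.toGrothendieck

/-- The contravariant functor `U ↦ C^∞(U)` to real algebras. -/
def cinfFunctor : OpenCinfᵒᵖ ⥤ CommAlgCat.{0} ℝ where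
  obj U := CommAlgCat.of ℝ (Cinf (𝓡 U.unop.dim) U.unop.carrier)
  map φ := CommAlgCat.ofHom (pullback (I := 𝓡 _) (J := 𝓡 _) φ.unop)
  map_id _ := rfl
  map_comp _ _ := rfl

/-! ### The Zariski topology on a category of real algebras

Here `𝒜` is a category of real algebras, with forgetful functor `R : 𝒜 ⥤ Alg_ℝ`. -/

section Zariski

variable {𝒜 : Type w} [Category.{v} 𝒜] (R : 𝒜 ⥤ CommAlgCat.{u} ℝ)

/-- `l : A ⟶ B` is a localization `A → A[f⁻¹]` in `𝒜`: it is universal among the morphisms of `𝒜`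
with source `A` that send `f` to a unit. -/
def IsLocalizationAt {A B : 𝒜} (f : R.obj A) (l : A ⟶ B) : Prop :=
  IsUnit ((R.map l).hom f) ∧
    ∀ (C : 𝒜) (g : A ⟶ C), IsUnit ((R.map g).hom f) → ∃! h : B ⟶ C, l ≫ h = g

/-- Families of localizations `A → A[f_i⁻¹]` such that the sets
`Spec_ℝ(A[f_i⁻¹]) = {x | x(f_i) ≠ 0}` cover `Spec_ℝ(A)`. -/
def zariskiCovers : Precoverage 𝒜ᵒᵖ where
  coverings A := {S | ∃ (ι : Type u) (f : ι → R.obj A.unop) (B : ι → 𝒜) (l : ∀ i, A.unop ⟶ B i),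
    (∀ i, IsLocalizationAt R (f i) (l i)) ∧
    (∀ x : RealSpec (R.obj A.unop), ∃ i, x (f i) ≠ 0) ∧
    S = Presieve.ofArrows (fun i => op (B i)) (fun i => (l i).op)}

/-- The Zariski topology on `𝒜ᵒᵖ`: generated by the localization coverings. -/
def zariskiTopology : GrothendieckTopology 𝒜ᵒᵖ := (zariskiCovers R).toGrothendieck

end Zariski

/-- `G` is an equivalence of sites: an equivalence of categories identifying the covering sieves
on both sides. -/
def IsSiteEquivalence {C D : Type*} [Category* C] [Category* D] (J : GrothendieckTopology C)
    (K : GrothendieckTopology D) (G : C ⥤ D) : Prop :=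
  G.IsEquivalence ∧ ∀ (X : C) (S : Sieve X), S ∈ J X ↔ S.functorPushforward G ∈ K (G.obj X)

end SmoothAlgebra

end

open SmoothAlgebra

/-!
The theorem rests on one fact: every character of `C^∞(M)` is the evaluation at a point
(`exists_eq_pointEval`). If a character `χ` differed from every evaluation, then a smooth exhaustion
function `h` and finitely many functions `f` with `χ f ≠ f x` on the compact set `h ≤ χ h` would
give a sum of squares `(h - χ h)² + ∑ (f - χ f)²` in the kernel of `χ` that vanishes nowhere, hence
is a unit. So `Spec_ℝ(C^∞(M)) = M`, and `C^∞(M)` is smoothly closed geometric because smooth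
functions compose. For `M = ℝⁿ` the point is the tuple of values of `χ` on the coordinates; as a
smoothly closed geometric algebra `A` embeds in the functions on `Spec_ℝ(A)`, a morphism
`C^∞(ℝⁿ) → A` is determined by the images of the coordinates, and these can be prescribed. This
makes `A` smoothly affine, and the coproduct in `Alg_sa` is the bijection `A^{p+q} = A^p × A^q`.

The smooth geometric closure of `A` is the algebra of all functions `f(ev_{a₁}, …, ev_{aₙ})` on
`Spec_ℝ(A)`; it has the same real spectrum, again by the description of the characters of `C^∞(ℝⁿ)`.

A morphism `C^∞(V) → C^∞(U)` gives a map `U → V` of spectra, which is smooth because the images of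
the coordinates are. An open `V ⊆ U` is the set `{f ≠ 0}` for some smooth `f`, and then
`C^∞(U) → C^∞(V)` is the localization at `f`, since a smooth map into `U` that makes `f` invertible
is one into `V`. So open coverings and localization coverings generate the same sieves
(`openTopology_le_restrictedTopology`, `functorPullback_mem_openTopology`).

For the coproduct of `C^∞(M)` and `C^∞(N)` in `Alg_scg`, morphisms to `A` define a map from
`Spec_ℝ(A)` to `M × N`, and the point is that the composition with a smooth `F` on `M × N` is
`ev_b` for some `b` in `A`. Since `A` is closed under smooth functions of finitely many variables
only, `F` has to be written as such a function of finitely many elements of `C^∞(M)` and `C^∞(N)`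
(`exists_eq_comp_append`). This is the weak Whitney embedding theorem for manifolds that need not be
compact (`exists_isRetractileEmbedding`) together with the extension of smooth functions from closed
submanifolds. A compact piece of `M` embeds in some vector space by finitely many charts, and a
projection along a generic direction keeps this property as long as the target has dimension more
than `2 dim M + 1`, because secants and tangents then form a set of smaller Hausdorff dimension
(`IsInjImmersionOn.exists_projection`). Now that the dimension does not depend on the piece, the
embeddings of the slabs `h⁻¹[k, k + 1]` of an exhaustion function `h` are joined, separately for `k`
even and `k` odd, and these two maps and `h` form a closed embedding.
-/

open SmoothAlgebra


noncomputable section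

namespace SmoothAlgebra

/-! ### Characters of algebras of smooth functions -/

section Characters

variable {E : Type*} [NormedAddCommGroup E] [NormedSpace ℝ E] {H : Type*} [TopologicalSpace H]
  {I : ModelWithCorners ℝ E H} {M : Type u} [TopologicalSpace M] [ChartedSpace H M]

/-- Evaluation at a point, as a character of `C^∞(M)`. -/
def pointEval (I : ModelWithCorners ℝ E H) {M : Type u} [TopologicalSpace M]
    [ChartedSpace H M] (x : M) : RealSpec (Cinf I M) :=
  (Pi.evalAlgHom ℝ (fun _ : M => ℝ) x).comp ContMDiffMap.coeFnAlgHom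

@[simp]
theorem pointEval_apply (x : M) (f : Cinf I M) : pointEval I x f = f x := rfl

theorem isUnit_iff_forall_ne_zero {f : Cinf I M} : IsUnit f ↔ ∀ x, f x ≠ 0 := by
  constructor
  · intro h x
    exact (h.map (pointEval I x)).ne_zero
  · intro h
    refine IsUnit.of_mul_eq_one ⟨fun x => (f x)⁻¹, f.contMDiff.inv₀ h⟩ ?_
    ext x
    exact mul_inv_cancel₀ (h x)

theorem exists_eq_zero_of_character (χ : RealSpec (Cinf I M)) {f : Cinf I M} (hf : χ f = 0) :
    ∃ x, f x = 0 := by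
  by_contra! h
  exact ((isUnit_iff_forall_ne_zero.2 h).map χ).ne_zero hf

theorem sigmaCompactSpace_of_chartedSpace (I : ModelWithCorners ℝ E H) (M : Type u)
    [TopologicalSpace M] [ChartedSpace H M] [FiniteDimensional ℝ E] [SecondCountableTopology M] :
    SigmaCompactSpace M := by
  have : LocallyCompactSpace H := I.locallyCompactSpace
  have : LocallyCompactSpace M := ChartedSpace.locallyCompactSpace H M
  infer_instance

variable [FiniteDimensional ℝ E] [IsManifold I ∞ M] [T2Space M] [SecondCountableTopology M]

/-- A smooth exhaustion function: it dominates the index function of a compact exhaustion. -/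
theorem exists_contMDiffMap_isCompact_sublevel :
    ∃ h : Cinf I M, ∀ c : ℝ, IsCompact {x | h x ≤ c} := by
  have : LocallyCompactSpace H := I.locallyCompactSpace
  have : LocallyCompactSpace M := ChartedSpace.locallyCompactSpace H M
  have := sigmaCompactSpace_of_chartedSpace I M
  let K : CompactExhaustion M := default
  obtain ⟨h, hh⟩ := exists_contMDiffMap_forall_mem_convex_of_local_const (n := ⊤) I
    (t := fun x : M => Set.Ici (K.find x : ℝ)) (fun x => convex_Ici _) (fun x => by
      refine ⟨(K.find x + 1 : ℕ), ?_⟩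
      have : interior (K (K.find x + 1)) ∈ nhds x :=
        isOpen_interior.mem_nhds (K.subset_interior_succ _ (K.mem_find x))
      filter_upwards [this] with y hy
      exact Set.mem_Ici.2 (Nat.cast_le.2 (K.mem_iff_find_le.1 (interior_subset hy))))
  refine ⟨h, fun c => ?_⟩
  refine (K.isCompact ⌊c⌋₊).of_isClosed_subset (isClosed_le h.contMDiff.continuous
    continuous_const) fun x hx => K.mem_iff_find_le.2 (Nat.le_floor ?_)
  exact le_trans (hh x) hx

/-- Every character of `C^∞(M)` is the evaluation at a point. If `χ` differed from every
evaluation, a smooth exhaustion function and finitely many `f` with `χ f ≠ f x` would give a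
nowhere vanishing sum of squares in the kernel of `χ`. -/
theorem exists_eq_pointEval (χ : RealSpec (Cinf I M)) : ∃ x : M, χ = pointEval I x := by
  by_contra! hne
  have hne' : ∀ x : M, ∃ f : Cinf I M, f x ≠ χ f := by
    intro x
    by_contra! hx
    exact hne x (AlgHom.ext fun f => (hx f).symm)
  choose f hf using hne'
  obtain ⟨h, hh⟩ := exists_contMDiffMap_isCompact_sublevel (I := I) (M := M)
  obtain ⟨t, -, ht⟩ := (hh (χ h)).elim_nhds_subcover (fun x => {y | f x y ≠ χ (f x)})
    (fun x _ => ((f x).contMDiff.continuous.continuousAt).eventually_ne (hf x))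
  let k (g : Cinf I M) : Cinf I M := g - algebraMap ℝ _ (χ g)
  have hk0 (g : Cinf I M) : χ (k g) = 0 := by simp [k]
  have hk1 (g : Cinf I M) (x : M) : k g x = g x - χ g := rfl
  obtain ⟨x, hx⟩ := exists_eq_zero_of_character χ
    (f := k h ^ 2 + ∑ y ∈ t, k (f y) ^ 2) (by simp [hk0])
  have hx' : k h x ^ 2 + ∑ y ∈ t, k (f y) x ^ 2 = 0 := by
    have : pointEval I x (k h ^ 2 + ∑ y ∈ t, k (f y) ^ 2) = 0 := hx
    simpa only [map_add, map_pow, map_sum, pointEval_apply] using this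
  have hnn : 0 ≤ ∑ y ∈ t, k (f y) x ^ 2 := Finset.sum_nonneg fun y _ => sq_nonneg _
  have h1 : k h x = 0 := by nlinarith [sq_nonneg (k h x)]
  have h2 : ∑ y ∈ t, k (f y) x ^ 2 = 0 := by nlinarith [sq_nonneg (k h x)]
  rw [hk1, sub_eq_zero] at h1
  have hxt := ht (show x ∈ {x | h x ≤ χ h} from h1.le)
  simp only [Set.mem_iUnion, Set.mem_ofPred_eq] at hxt
  obtain ⟨y, hy, hxy⟩ := hxt
  have h3 := (Finset.sum_eq_zero_iff_of_nonneg fun y _ => sq_nonneg _).1 h2 y hy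
  rw [sq_eq_zero_iff, hk1, sub_eq_zero] at h3
  exact hxy h3

theorem exists_apply_ne {x y : M} (hxy : x ≠ y) : ∃ f : Cinf I M, f x ≠ f y := by
  have := sigmaCompactSpace_of_chartedSpace I M
  obtain ⟨f, h0, h1, -⟩ := exists_contMDiffMap_zero_one_of_isClosed (n := ⊤) I
    (isClosed_singleton (x := x)) (isClosed_singleton (x := y)) (by simpa using hxy)
  refine ⟨f, ?_⟩
  rw [h0 (Set.mem_singleton x), h1 (Set.mem_singleton y)]
  exact zero_ne_one

theorem pointEval_injective : Function.Injective (pointEval I (M := M)) := by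
  intro x y h
  by_contra hxy
  obtain ⟨f, hf⟩ := exists_apply_ne (I := I) hxy
  exact hf (DFunLike.congr_fun h f)

end Characters

/-- A character of `C^∞(ℝⁿ)` is the evaluation at the point given by its values on the
coordinates. -/
theorem character_cinfEuc_apply {n : ℕ} (χ : RealSpec (CinfEuc n)) (f : CinfEuc n) :
    χ f = f (WithLp.toLp 2 fun i => χ (coord n i)) := by
  obtain ⟨x, rfl⟩ := exists_eq_pointEval χ
  rfl

/-! ### Smoothly closed geometric algebras -/

/-- The morphism `a ↦ ev_a` from an algebra to the functions on its real spectrum. -/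
def evAlgHom (A : Type u) [CommRing A] [Algebra ℝ A] : A →ₐ[ℝ] (RealSpec A → ℝ) :=
  AlgHom.pi fun x => x

namespace IsSmoothlyClosedGeometric

variable {A : Type u} [CommRing A] [Algebra ℝ A]

theorem ev_injective (hA : IsSmoothlyClosedGeometric A) : Function.Injective (ev (A := A)) := by
  intro a b hab
  obtain ⟨c, -, hc⟩ := hA 1 (fun _ => a) (coord 1 0)
  exact (hc a rfl).trans (hc b hab).symm

theorem ext_character (hA : IsSmoothlyClosedGeometric A) {a b : A}
    (h : ∀ x : RealSpec A, x a = x b) : a = b :=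
  hA.ev_injective (funext h)

theorem algHom_ext (hA : IsSmoothlyClosedGeometric A) {B : Type v} [CommRing B] [Algebra ℝ B]
    {φ ψ : B →ₐ[ℝ] A} (h : ∀ x : RealSpec A, x.comp φ = x.comp ψ) : φ = ψ :=
  AlgHom.ext fun b => hA.ext_character fun x => DFunLike.congr_fun (h x) b

/-- A morphism from `B` to the functions on `Spec_ℝ(A)` with values in `A` lifts to `A`. -/
theorem exists_algHom_of_ev (hA : IsSmoothlyClosedGeometric A) {B : Type v} [CommRing B]
    [Algebra ℝ B] (Φ : RealSpec A → RealSpec B)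
    (h : ∀ b : B, ∃ a : A, ∀ x, x a = Φ x b) :
    ∃ φ : B →ₐ[ℝ] A, ∀ x : RealSpec A, x.comp φ = Φ x := by
  have hinj : Function.Injective (evAlgHom A) := hA.ev_injective
  let e := AlgEquiv.ofInjective (evAlgHom A) hinj
  let Ψ : B →ₐ[ℝ] (evAlgHom A).range := (AlgHom.pi Φ).codRestrict _ (fun b => by
    obtain ⟨a, ha⟩ := h b
    exact ⟨a, funext ha⟩)
  refine ⟨(e.symm : _ →ₐ[ℝ] A).comp Ψ, fun x => AlgHom.ext fun b => ?_⟩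
  have h1 : e (e.symm (Ψ b)) = Ψ b := e.apply_symm_apply _
  exact congrFun (congrArg Subtype.val h1) x

theorem isSmoothlyAffine (hA : IsSmoothlyClosedGeometric A) : IsSmoothlyAffine A := by
  intro n
  constructor
  · intro φ ψ h
    refine hA.algHom_ext fun x => AlgHom.ext fun f => ?_
    rw [character_cinfEuc_apply, character_cinfEuc_apply (x.comp ψ)]
    congr 2
    funext i
    exact congrArg x (congrFun h i)
  · intro a
    obtain ⟨φ, hφ⟩ := hA.exists_algHom_of_ev
      (fun x => pointEval (𝓡 n) (WithLp.toLp 2 fun i => ev (a i) x : Euc n)) (fun f => by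
        obtain ⟨b, hb, -⟩ := hA n a f
        exact ⟨b, fun x => (congrFun hb x).symm⟩)
    exact ⟨φ, funext fun i => hA.ext_character fun x => DFunLike.congr_fun (hφ x) (coord n i)⟩

end IsSmoothlyClosedGeometric

theorem isSmoothlyClosedGeometric_cinf {E : Type*} [NormedAddCommGroup E] [NormedSpace ℝ E]
    [FiniteDimensional ℝ E] {H : Type*} [TopologicalSpace H] (I : ModelWithCorners ℝ E H)
    (M : Type u) [TopologicalSpace M] [ChartedSpace H M] [IsManifold I ∞ M] [T2Space M]
    [SecondCountableTopology M] : IsSmoothlyClosedGeometric (Cinf I M) := by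
  intro n a f
  have ha : ContMDiff I (𝓡 n) ∞ fun x : M => (WithLp.toLp 2 fun i => a i x : Euc n) :=
    (by fun_prop : ContDiff ℝ ∞ fun y : Fin n → ℝ => (WithLp.toLp 2 y : Euc n)).contMDiff.comp
      (contMDiff_pi_space.2 fun i => (a i).contMDiff)
  refine ⟨ContMDiffMap.comp f ⟨_, ha⟩, funext fun χ => ?_, fun b hb => ?_⟩
  · obtain ⟨x, rfl⟩ := exists_eq_pointEval χ
    rfl
  · ext x
    exact (congrFun hb (pointEval I x)).symm

/-! ### The coproduct of `C^∞(ℝ^p)` and `C^∞(ℝ^q)` -/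

theorem smoothlyAffine_cinfEuc (n : ℕ) : smoothlyAffine (CommAlgCat.of ℝ (CinfEuc n)) :=
  (isSmoothlyClosedGeometric_cinf (𝓡 n) (Euc n)).isSmoothlyAffine

/-- The universal property of the coproduct in a full subcategory of algebras, in terms of algebra
morphisms. -/
theorem nonempty_isColimit_binaryCofan {P : ObjectProperty (CommAlgCat.{u} ℝ)}
    {A B C : P.FullSubcategory} (f : A ⟶ C) (g : B ⟶ C)
    (h : ∀ (D : P.FullSubcategory) (φ : A.obj →ₐ[ℝ] D.obj) (ψ : B.obj →ₐ[ℝ] D.obj),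
      ∃! χ : C.obj →ₐ[ℝ] D.obj, χ.comp f.hom.hom = φ ∧ χ.comp g.hom.hom = ψ) :
    Nonempty (IsColimit (BinaryCofan.mk f g)) := by
  refine ⟨BinaryCofan.IsColimit.mk _
    (fun {D} φ ψ => ObjectProperty.homMk
      (CommAlgCat.ofHom (h D φ.hom.hom ψ.hom.hom).choose)) ?_ ?_ ?_⟩
  · intro D φ ψ
    ext x
    exact DFunLike.congr_fun (h D φ.hom.hom ψ.hom.hom).choose_spec.1.1 x
  · intro D φ ψ
    ext x
    exact DFunLike.congr_fun (h D φ.hom.hom ψ.hom.hom).choose_spec.1.2 x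
  · intro D φ ψ m h1 h2
    ext x
    refine DFunLike.congr_fun ((h D φ.hom.hom ψ.hom.hom).choose_spec.2 m.hom.hom ⟨?_, ?_⟩) x
    · rw [← h1]; rfl
    · rw [← h2]; rfl

theorem IsSmoothlyAffine.existsUnique_algHom_cinfEuc_add {A : Type u} [CommRing A] [Algebra ℝ A]
    (hA : IsSmoothlyAffine A) {p q : ℕ} (φ : CinfEuc p →ₐ[ℝ] A) (ψ : CinfEuc q →ₐ[ℝ] A) :
    ∃! χ : CinfEuc (p + q) →ₐ[ℝ] A,
      χ.comp (pullback (projLeft p q)) = φ ∧ χ.comp (pullback (projRight p q)) = ψ := by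
  obtain ⟨χ, hχ⟩ := (hA (p + q)).2
    (Fin.append (fun i => φ (coord p i)) (fun i => ψ (coord q i)))
  refine ⟨χ, ⟨(hA p).1 (funext fun i => ?_), (hA q).1 (funext fun i => ?_)⟩, ?_⟩
  · exact (congrFun hχ (Fin.castAdd q i)).trans (Fin.append_left _ _ _)
  · exact (congrFun hχ (Fin.natAdd p i)).trans (Fin.append_right _ _ _)
  · rintro χ' ⟨rfl, rfl⟩
    refine (hA (p + q)).1 (Eq.trans (funext fun i => ?_) hχ.symm)
    induction i using Fin.addCases with
    | left i => rw [Fin.append_left]; rfl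
    | right i => rw [Fin.append_right]; rfl

/-! ### The smooth geometric closure -/

section Closure

variable (A : Type u) [CommRing A] [Algebra ℝ A]

/-- The smooth geometric closure of `A`: the algebra of all functions on `Spec_ℝ(A)` that are smooth
functions of finitely many of the functions `ev_a`. The finitely many elements are indexed by an
arbitrary finite type, so that such families can be joined without renumbering. -/
def scgClosure : Subalgebra ℝ (RealSpec A → ℝ) where
  carrier := {F | ∃ (ι : Type) (_ : Fintype ι) (a : ι → A) (f : (ι → ℝ) → ℝ),
    ContDiff ℝ ∞ f ∧ F = fun x => f fun i => x (a i)}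
  mul_mem' := by
    rintro _ _ ⟨ι, _, a, f, hf, rfl⟩ ⟨κ, _, b, g, hg, rfl⟩
    exact ⟨ι ⊕ κ, inferInstance, Sum.elim a b,
      fun y => f (fun i => y (.inl i)) * g (fun i => y (.inr i)), by fun_prop, rfl⟩
  add_mem' := by
    rintro _ _ ⟨ι, _, a, f, hf, rfl⟩ ⟨κ, _, b, g, hg, rfl⟩
    exact ⟨ι ⊕ κ, inferInstance, Sum.elim a b,
      fun y => f (fun i => y (.inl i)) + g (fun i => y (.inr i)), by fun_prop, rfl⟩
  algebraMap_mem' r := ⟨Empty, inferInstance, Empty.elim, fun _ => r, contDiff_const, rfl⟩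

variable {A}

theorem ev_mem_scgClosure (a : A) : ev a ∈ scgClosure A :=
  ⟨Unit, inferInstance, fun _ => a, fun y => y (), by fun_prop, rfl⟩

theorem comp_mem_scgClosure {n : ℕ} {F : Fin n → RealSpec A → ℝ} (hF : ∀ i, F i ∈ scgClosure A)
    {g : (Fin n → ℝ) → ℝ} (hg : ContDiff ℝ ∞ g) : (fun x => g fun i => F i x) ∈ scgClosure A := by
  choose ι _ a f hf hFf using hF
  refine ⟨Σ i, ι i, inferInstance, fun j => a j.1 j.2,
    fun y => g fun i => f i fun j => y ⟨i, j⟩, ?_, ?_⟩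
  · exact hg.comp (contDiff_pi.2 fun i => (hf i).comp (by fun_prop))
  · funext x
    simp only [hFf]

theorem contDiff_comp_ofLp {n : ℕ} (f : CinfEuc n) :
    ContDiff ℝ ∞ fun y : Fin n → ℝ => f (WithLp.toLp 2 y) :=
  f.contMDiff.contDiff.comp (by fun_prop)

theorem exists_fin_of_mem_scgClosure {F : RealSpec A → ℝ} (hF : F ∈ scgClosure A) :
    ∃ (n : ℕ) (a : Fin n → A) (f : CinfEuc n),
      F = fun x => f (WithLp.toLp 2 fun i => x (a i)) := by
  obtain ⟨ι, _, a, f, hf, rfl⟩ := hF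
  let e := Fintype.equivFin ι
  refine ⟨_, fun i => a (e.symm i), ⟨fun y => f fun i => y (e i), ?_⟩, ?_⟩
  · exact (hf.comp (by fun_prop)).contMDiff
  · funext x
    simp

variable (A) in
/-- The canonical morphism from `A` to its smooth geometric closure. -/
def toScgClosure : A →ₐ[ℝ] scgClosure A :=
  (evAlgHom A).codRestrict _ ev_mem_scgClosure

/-- The real spectrum does not change under the passage to the smooth geometric closure. -/
theorem character_scgClosure_apply (χ : RealSpec (scgClosure A)) (F : scgClosure A) :
    χ F = F.1 (χ.comp (toScgClosure A)) := by
  obtain ⟨F, hF⟩ := F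
  obtain ⟨n, a, f, rfl⟩ := exists_fin_of_mem_scgClosure hF
  let Ψ : CinfEuc n →ₐ[ℝ] scgClosure A :=
    (AlgHom.pi fun x : RealSpec A =>
      pointEval (𝓡 n) (WithLp.toLp 2 fun i => x (a i) : Euc n)).codRestrict _
      (fun g => ⟨Fin n, inferInstance, a, _, contDiff_comp_ofLp g, rfl⟩)
  exact character_cinfEuc_apply (χ.comp Ψ) f

variable (A) in
theorem isSmoothlyClosedGeometric_scgClosure : IsSmoothlyClosedGeometric (scgClosure A) := by
  intro n F f
  refine ⟨⟨_, comp_mem_scgClosure (fun i => (F i).2) (contDiff_comp_ofLp f)⟩,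
    funext fun χ => ?_, fun b hb => Subtype.ext (funext fun x => ?_)⟩
  · simp only [ev, character_scgClosure_apply]
  · exact (congrFun hb ((Pi.evalAlgHom ℝ (fun _ => ℝ) x).comp (scgClosure A).val)).symm

theorem existsUnique_algHom_scgClosure {B : Type u} [CommRing B] [Algebra ℝ B]
    (hB : IsSmoothlyClosedGeometric B) (φ : A →ₐ[ℝ] B) :
    ∃! ψ : scgClosure A →ₐ[ℝ] B, ψ.comp (toScgClosure A) = φ := by
  obtain ⟨ψ, hψ⟩ := hB.exists_algHom_of_ev (fun x : RealSpec B =>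
    (Pi.evalAlgHom ℝ (fun _ => ℝ) (x.comp φ)).comp (scgClosure A).val) (by
      rintro ⟨F, hF⟩
      obtain ⟨n, a, f, rfl⟩ := exists_fin_of_mem_scgClosure hF
      obtain ⟨b, hb, -⟩ := hB n (fun i => φ (a i)) f
      exact ⟨b, fun x => (congrFun hb x).symm⟩)
  refine ⟨ψ, hB.algHom_ext fun x => ?_, ?_⟩
  · rw [← AlgHom.comp_assoc, hψ]
    rfl
  · rintro ψ' rfl
    refine hB.algHom_ext fun x => AlgHom.ext fun F => ?_
    rw [hψ, character_scgClosure_apply]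
    rfl

end Closure

theorem isRightAdjoint_smoothlyClosedGeometric_ι :
    (smoothlyClosedGeometric.{u}.ι : AlgSCG.{u} ⥤ CommAlgCat.{u} ℝ).IsRightAdjoint := by
  have h (A : CommAlgCat.{u} ℝ) :
      HasInitial (StructuredArrow A smoothlyClosedGeometric.{u}.ι) := by
    let X : AlgSCG.{u} :=
      ⟨CommAlgCat.of ℝ (scgClosure A), isSmoothlyClosedGeometric_scgClosure A⟩
    have key (Y : StructuredArrow A smoothlyClosedGeometric.{u}.ι) :=
      existsUnique_algHom_scgClosure Y.right.property Y.hom.hom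
    let t : StructuredArrow A smoothlyClosedGeometric.{u}.ι :=
      StructuredArrow.mk (Y := X) (CommAlgCat.ofHom (toScgClosure A))
    refine IsInitial.hasInitial (X := t) (IsInitial.ofUniqueHom
      (fun Y => StructuredArrow.homMk
        (ObjectProperty.homMk (CommAlgCat.ofHom (key Y).choose)) ?_) ?_)
    · ext a
      exact DFunLike.congr_fun (key Y).choose_spec.1 a
    · intro Y m
      ext a
      refine DFunLike.congr_fun ((key Y).choose_spec.2 m.right.hom.hom ?_) a
      ext a
      exact (congrArg (fun f => f.hom a) (StructuredArrow.w m))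
  exact isRightAdjointOfStructuredArrowInitials _

/-! ### Morphisms between algebras of smooth functions on open subsets -/

section Morphisms

variable {E : Type*} [NormedAddCommGroup E] [NormedSpace ℝ E] {H : Type*} [TopologicalSpace H]
  {I : ModelWithCorners ℝ E H} {M : Type u} [TopologicalSpace M] [ChartedSpace H M]

theorem contMDiff_opens_iff {n : ℕ} {V : Opens (Euc n)} {ψ : M → V} :
    ContMDiff I (𝓡 n) ∞ ψ ↔ ContMDiff I (𝓡 n) ∞ fun x => (ψ x : Euc n) :=
  (ContMDiff.subtypeVal_comp_iff V ψ).symm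

/-- The restriction of the coordinate function `x_i` to an open subset of `ℝⁿ`. -/
def coordOn {n : ℕ} (V : Opens (Euc n)) (i : Fin n) : Cinf (𝓡 n) V :=
  ContMDiffMap.comp (coord n i) ⟨Subtype.val, contMDiff_subtype_val⟩

theorem pullback_injective {n : ℕ} {V : Opens (Euc n)} :
    Function.Injective
      (pullback : C^∞⟮I, M; 𝓡 n, V⟯ → (Cinf (𝓡 n) V →ₐ[ℝ] Cinf I M)) := by
  intro φ ψ h
  ext x i
  exact DFunLike.congr_fun (DFunLike.congr_fun h (coordOn V i)) x

/-- Morphisms between algebras of smooth functions come from smooth maps: the characters of the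
target determine the map, and the images of the coordinates show that it is smooth. -/
theorem pullback_surjective {n : ℕ} {V : Opens (Euc n)} :
    Function.Surjective
      (pullback : C^∞⟮I, M; 𝓡 n, V⟯ → (Cinf (𝓡 n) V →ₐ[ℝ] Cinf I M)) := by
  intro φ
  choose ψ hψ using fun x : M => exists_eq_pointEval ((pointEval I x).comp φ)
  have hφ (f : Cinf (𝓡 n) V) (x : M) : φ f x = f (ψ x) := DFunLike.congr_fun (hψ x) f
  have hsmooth : ContMDiff I (𝓡 n) ∞ ψ := by
    rw [contMDiff_opens_iff]
    have h1 : ContMDiff I 𝓘(ℝ, Fin n → ℝ) ∞ fun x i => φ (coordOn V i) x :=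
      contMDiff_pi_space.2 fun i => (φ (coordOn V i)).contMDiff
    refine ((by fun_prop : ContDiff ℝ ∞ fun y : Fin n → ℝ =>
      (WithLp.toLp 2 y : Euc n)).contMDiff.comp h1).congr fun x => ?_
    ext i
    exact (hφ (coordOn V i) x).symm
  exact ⟨⟨ψ, hsmooth⟩, AlgHom.ext fun f => ContMDiffMap.ext fun x => (hφ f x).symm⟩

end Morphisms

instance : cinfFunctor.Full where
  map_surjective {U V} φ := by
    obtain ⟨ψ, hψ⟩ := pullback_surjective (I := 𝓡 _) (V := U.unop.carrier) φ.hom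
    refine ⟨Quiver.Hom.op (X := V.unop) (Y := U.unop) ψ, ?_⟩
    ext x
    exact DFunLike.congr_fun hψ x

instance : cinfFunctor.Faithful where
  map_injective {U _} _ _ h := Quiver.Hom.unop_inj
    (pullback_injective (I := 𝓡 _) (V := U.unop.carrier) (congrArg CommAlgCat.Hom.hom h))

theorem smoothlyAffine_cinfFunctor (U : OpenCinfᵒᵖ) : smoothlyAffine (cinfFunctor.obj U) :=
  (isSmoothlyClosedGeometric_cinf (𝓡 _) U.unop.carrier).isSmoothlyAffine

/-! ### Localizations and open subsets -/

instance {n : ℕ} {V U : Opens (Euc n)} (h : V ≤ U) : Mono (OpenCinf.incl h) where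
  right_cancellation {W} φ ψ hφψ := by
    refine ContMDiffMap.ext fun x => Subtype.ext ?_
    exact congrArg (fun χ : C^∞⟮𝓡 W.dim, W.carrier; 𝓡 n, U⟯ => (χ x : Euc n)) hφψ

/-- A smooth map into `U` that pulls `f` back to a unit factors through `{f ≠ 0}`. -/
theorem OpenCinf.exists_comp_incl_eq {n : ℕ} {V U : Opens (Euc n)} (hVU : V ≤ U)
    (f : Cinf (𝓡 n) U) (hf : ∀ x : U, f x ≠ 0 → (x : Euc n) ∈ V) {W : OpenCinf}
    (ψ : W ⟶ OpenCinf.mk n U)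
    (hψ : IsUnit (pullback (I := 𝓡 W.dim) (J := 𝓡 n) (M := W.carrier) (N := U) ψ f)) :
    ∃ χ : W ⟶ OpenCinf.mk n V, χ ≫ OpenCinf.incl hVU = ψ := by
  let ψ' : C^∞⟮𝓡 W.dim, W.carrier; 𝓡 n, U⟯ := ψ
  let χ : W.carrier → V := fun x => ⟨ψ' x, hf _ (isUnit_iff_forall_ne_zero.1 hψ x)⟩
  have hχ : ContMDiff (𝓡 W.dim) (𝓡 n) ∞ χ :=
    contMDiff_opens_iff.2 (contMDiff_opens_iff (ψ := ψ').1 ψ'.contMDiff)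
  exact ⟨(⟨χ, hχ⟩ : C^∞⟮𝓡 W.dim, W.carrier; 𝓡 n, V⟯), rfl⟩

theorem isUnit_cinfFunctor_map_incl {n : ℕ} {V U : Opens (Euc n)} (hVU : V ≤ U)
    (f : Cinf (𝓡 n) U) (hf : ∀ x : U, (x : Euc n) ∈ V → f x ≠ 0) :
    IsUnit ((cinfFunctor.map (OpenCinf.incl hVU).op).hom f) :=
  isUnit_iff_forall_ne_zero (I := 𝓡 n) (M := V).2 fun x => hf _ x.2

/-- The functor `U ↦ C^∞(U)` from `Open_{C^∞}` to `Alg_sa`. -/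
abbrev cinfSA : OpenCinfᵒᵖ ⥤ AlgSA.{0} := smoothlyAffine.lift cinfFunctor smoothlyAffine_cinfFunctor

/-- The forgetful functor from `Alg_{C^∞}` to real algebras. -/
abbrev forgetCinf : cinfSA.EssImageSubcategory ⥤ CommAlgCat.{0} ℝ :=
  cinfSA.essImage.ι ⋙ smoothlyAffine.ι

/-- Restriction to `{f ≠ 0}` is the localization at `f` in `Alg_{C^∞}`. -/
theorem isLocalizationAt_incl {n : ℕ} {V U : Opens (Euc n)} (hVU : V ≤ U)
    (f : Cinf (𝓡 n) U) (hf : ∀ x : U, f x ≠ 0 ↔ (x : Euc n) ∈ V) :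
    IsLocalizationAt forgetCinf (A := cinfSA.toEssImage.obj (op (OpenCinf.mk n U))) f
      (cinfSA.toEssImage.map (OpenCinf.incl hVU).op) := by
  refine ⟨isUnit_cinfFunctor_map_incl hVU f fun x => (hf x).2, fun C g hg => ?_⟩
  let e := cinfSA.toEssImage.objObjPreimageIso C
  set W := (cinfSA.toEssImage.objPreimage C).unop
  obtain ⟨ψ, hψ⟩ := cinfSA.toEssImage.map_surjective (Y := op W) (g ≫ e.inv)
  have hunit : IsUnit ((forgetCinf.map (cinfSA.toEssImage.map ψ)).hom f) := by
    rw [hψ, Functor.map_comp]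
    exact hg.map (forgetCinf.map e.inv).hom
  obtain ⟨χ, hχ⟩ := OpenCinf.exists_comp_incl_eq hVU f (fun x => (hf x).1) ψ.unop hunit
  refine ⟨cinfSA.toEssImage.map χ.op ≫ e.hom, ?_, fun h hh => ?_⟩
  · beta_reduce
    rw [← Category.assoc, ← Functor.map_comp, ← op_comp, hχ, Quiver.Hom.op_unop, hψ,
      Category.assoc, e.inv_hom_id, Category.comp_id]
  · obtain ⟨χ', hχ'⟩ := cinfSA.toEssImage.map_surjective (Y := op W) (h ≫ e.inv)
    have h1 : χ'.unop = χ := by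
      rw [← cancel_mono (OpenCinf.incl hVU), hχ]
      refine Quiver.Hom.op_inj (cinfSA.toEssImage.map_injective ?_)
      rw [op_comp, Functor.map_comp, Quiver.Hom.op_unop, Quiver.Hom.op_unop, hχ', hψ,
        ← Category.assoc, hh]
    rw [← h1, Quiver.Hom.op_unop, hχ', Category.assoc, e.inv_hom_id, Category.comp_id]

/-! ### The equivalence of sites -/

/-- The functor `U ↦ C^∞(U)` as a covariant functor to the opposite of `Alg_{C^∞}`. -/
abbrev cinfSite : OpenCinf ⥤ cinfSA.EssImageSubcategoryᵒᵖ := cinfSA.toEssImage.rightOp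

instance : cinfSite.IsEquivalence where
  essSurj := ⟨fun Y => by
    obtain ⟨X, ⟨e⟩⟩ := Functor.EssSurj.mem_essImage (F := cinfSA.toEssImage) Y.unop
    exact ⟨X.unop, ⟨e.symm.op⟩⟩⟩

/-- Open coverings become Zariski coverings, because every open subset of `U` is the set where some
smooth function on `U` does not vanish. -/
theorem openTopology_le_restrictedTopology :
    openTopology ≤ cinfSite.restrictedTopology (zariskiTopology forgetCinf) := by
  refine Precoverage.toGrothendieck_le_iff_le_toPrecoverage.2 ?_
  rintro ⟨n, U⟩ R ⟨ι, V, hV, hcov, rfl⟩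
  rw [GrothendieckTopology.mem_toPrecoverage_iff, Functor.mem_restrictedTopology_iff]
  choose f hf hsmooth _ using fun i => (V i).isOpen.exists_contDiff_support_eq (n := ⊤)
  let F (i : ι) : Cinf (𝓡 n) U :=
    ContMDiffMap.comp (⟨f i, (hsmooth i).contMDiff⟩ : CinfEuc n)
      ⟨Subtype.val, contMDiff_subtype_val⟩
  have hF (i : ι) (x : U) : F i x ≠ 0 ↔ (x : Euc n) ∈ V i := by
    rw [← SetLike.mem_coe, ← hf i]
    rfl
  have key : Presieve.ofArrows (fun i => cinfSite.obj (OpenCinf.mk n (V i)))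
      (fun i => cinfSite.map (OpenCinf.incl (hV i))) ∈
        zariskiCovers forgetCinf (cinfSite.obj (OpenCinf.mk n U)) := by
    refine ⟨ι, F, fun i => cinfSA.toEssImage.obj (op (OpenCinf.mk n (V i))), _,
      fun i => isLocalizationAt_incl (hV i) (F i) (hF i), fun χ => ?_, rfl⟩
    obtain ⟨x, rfl⟩ := exists_eq_pointEval (I := 𝓡 n) (M := U) χ
    obtain ⟨i, hi⟩ := Opens.mem_iSup.1 (hcov x.2)
    exact ⟨i, (hF i x).2 hi⟩
  refine GrothendieckTopology.superset_covering _ ?_ (Precoverage.generate_mem_toGrothendieck key)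
  rw [Sieve.generate_le_iff, Presieve.ofArrows_le_iff]
  intro i
  exact Sieve.image_mem_functorPushforward _ _ 
    (Sieve.le_generate _ _ _ (Presieve.ofArrows.mk i))

/-- A Zariski covering of `C^∞(U)` pulls back to a sieve that contains an open covering: if
`A → A[f_i⁻¹]` is a Zariski covering of `A` and `m : A → C^∞(U)` a morphism, then the restriction of
`m` to `{m(f_i) ≠ 0}` factors through `A[f_i⁻¹]`. The induction on the generation of the topology
needs the arbitrary `m`. -/
theorem functorPullback_mem_openTopology {Y : cinfSA.EssImageSubcategoryᵒᵖ} {T : Sieve Y}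
    (hT : T ∈ zariskiTopology forgetCinf Y) (U : OpenCinf) (m : cinfSite.obj U ⟶ Y) :
    (T.pullback m).functorPullback cinfSite ∈ openTopology U := by
  induction hT generalizing U with
  | of Y S hS =>
    obtain ⟨ι, f, B, l, hl, hcov, rfl⟩ := hS
    obtain ⟨n, U⟩ := U
    let g (i : ι) : Cinf (𝓡 n) U := (forgetCinf.map m.unop).hom (f i)
    have hopen (i : ι) : IsOpen {x : U | g i x ≠ 0} :=
      isOpen_ne_fun (g i).contMDiff.continuous continuous_const
    let V (i : ι) : Opens (Euc n) :=
      ⟨Subtype.val '' {x : U | g i x ≠ 0}, U.isOpen.isOpenMap_subtype_val _ (hopen i)⟩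
    have hV (i : ι) : V i ≤ U := by
      rintro _ ⟨x, -, rfl⟩
      exact x.2
    have hgV (i : ι) (x : U) (hx : (x : Euc n) ∈ V i) : g i x ≠ 0 := by
      obtain ⟨y, hy, hyx⟩ := hx
      rwa [← Subtype.ext hyx]
    have key : Presieve.ofArrows (fun i => OpenCinf.mk n (V i)) (fun i => OpenCinf.incl (hV i)) ∈
        openCovers (OpenCinf.mk n U) := by
      refine ⟨ι, V, hV, fun x hx => ?_, rfl⟩
      obtain ⟨i, hi⟩ := hcov ((pointEval (𝓡 n) (⟨x, hx⟩ : U)).comp (forgetCinf.map m.unop).hom)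
      exact Opens.mem_iSup.2 ⟨i, ⟨x, hx⟩, hi, rfl⟩
    refine GrothendieckTopology.superset_covering _ ?_
      (Precoverage.generate_mem_toGrothendieck key)
    rw [Sieve.generate_le_iff, Presieve.ofArrows_le_iff]
    intro i
    have hunit := isUnit_cinfFunctor_map_incl (hV i) (g i) (hgV i)
    obtain ⟨h, hh, -⟩ := (hl i).2 _
      (m.unop ≫ cinfSA.toEssImage.map (OpenCinf.incl (hV i)).op) (by
        rw [Functor.map_comp]
        exact hunit)
    refine ⟨op (B i), h.op, (l i).op, Presieve.ofArrows.mk i, ?_⟩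
    exact congrArg Quiver.Hom.op hh
  | top Y =>
    rw [Sieve.pullback_top, Sieve.functorPullback_top]
    exact openTopology.top_mem U
  | pullback Y S _ Z φ ih =>
    rw [← Sieve.pullback_comp]
    exact ih U (m ≫ φ)
  | transitive Y S R _ _ ihS ihR =>
    refine openTopology.transitive (ihS U m) _ fun W φ hφ => ?_
    have := ihR hφ W (𝟙 _)
    rw [Sieve.pullback_id] at this
    refine openTopology.superset_covering (fun Z ψ hψ => ?_) this
    simpa using hψ

theorem isSiteEquivalence_cinfSite :
    IsSiteEquivalence openTopology (zariskiTopology forgetCinf) cinfSite := by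
  refine ⟨inferInstance, fun U S => ⟨fun hS => ?_, fun hS => ?_⟩⟩
  · exact Functor.mem_restrictedTopology_iff.1 (openTopology_le_restrictedTopology _ hS)
  · have := functorPullback_mem_openTopology hS U (𝟙 _)
    rw [Sieve.pullback_id] at this
    rwa [(Sieve.fullyFaithfulFunctorGaloisCoinsertion cinfSite U).u_l_eq S] at this

/-! ### Dimension of secants and tangents -/

section Dimension

open Module Set Filter Topology

theorem dimH_image_le_of_contDiffAt {E F : Type*} [NormedAddCommGroup E] [NormedSpace ℝ E]
    [FiniteDimensional ℝ E] [NormedAddCommGroup F] [NormedSpace ℝ F] {f : E → F} {s : Set E}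
    (hf : ∀ x ∈ s, ContDiffAt ℝ 1 f x) : dimH (f '' s) ≤ dimH s :=
  dimH_image_le_of_locally_lipschitzOn fun x hx => by
    obtain ⟨K, t, ht, hK⟩ := (hf x hx).exists_lipschitzOnWith
    exact ⟨K, t, mem_nhdsWithin_of_mem_nhds ht, hK⟩

variable {E : Type*} [NormedAddCommGroup E] [NormedSpace ℝ E] {H : Type*} [TopologicalSpace H]
  {I : ModelWithCorners ℝ E H} {M : Type u} [TopologicalSpace M] [ChartedSpace H M]
  {F : Type*} [NormedAddCommGroup F] [NormedSpace ℝ F] {f : M → F}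

variable (I M) in
theorem exists_countable_iUnion_extChartAt_source [SecondCountableTopology M] :
    ∃ s : Set M, s.Countable ∧ ∀ x : M, ∃ p ∈ s, x ∈ (extChartAt I p).source := by
  obtain ⟨s, hs, hsu⟩ := countable_cover_nhds (f := fun p : M => (extChartAt I p).source)
    fun p => extChartAt_source_mem_nhds p
  refine ⟨s, hs, fun x => ?_⟩
  have : x ∈ ⋃ p ∈ s, (extChartAt I p).source := hsu ▸ mem_univ x
  simpa using this

theorem dimH_prod_le [FiniteDimensional ℝ E] (s : Set (E × E)) : dimH s ≤ (2 * finrank ℝ E : ℕ) := by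
  have : (finrank ℝ (E × E)) = 2 * finrank ℝ E := by rw [finrank_prod, two_mul]
  rw [← this, ← Real.dimH_univ_eq_finrank (E × E)]
  exact dimH_mono (subset_univ s)

variable [I.Boundaryless] [IsManifold I ∞ M]

theorem contDiffAt_comp_extChartAt_symm (hf : ContMDiff I 𝓘(ℝ, F) ∞ f) (p : M) {z : E}
    (hz : z ∈ (extChartAt I p).target) : ContDiffAt ℝ ∞ (f ∘ (extChartAt I p).symm) z := by
  rw [← contMDiffAt_iff_contDiffAt]
  exact hf.contMDiffAt.comp z
    ((contMDiffOn_extChartAt_symm p).contMDiffAt ((isOpen_extChartAt_target p).mem_nhds hz))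

theorem mfderiv_eq_fderiv_comp_mfderiv_extChartAt (hf : ContMDiff I 𝓘(ℝ, F) ∞ f) (p : M) {x : M}
    (hx : x ∈ (extChartAt I p).source) (w : TangentSpace I x) :
    mfderiv I 𝓘(ℝ, F) f x w =
      fderiv ℝ (f ∘ (extChartAt I p).symm) (extChartAt I p x)
        (mfderiv I 𝓘(ℝ, E) (extChartAt I p) x w) := by
  have h1 : f =ᶠ[𝓝 x] (f ∘ (extChartAt I p).symm) ∘ extChartAt I p := by
    filter_upwards [extChartAt_source_mem_nhds' hx] with y hy
    rw [Function.comp_apply, Function.comp_apply, (extChartAt I p).left_inv hy]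
  have h2 : MDifferentiableAt I 𝓘(ℝ, E) (extChartAt I p) x :=
    (contMDiffAt_extChartAt' (n := ∞) (by simpa using hx)).mdifferentiableAt (by simp)
  have h3 : MDifferentiableAt 𝓘(ℝ, E) 𝓘(ℝ, F) (f ∘ (extChartAt I p).symm) (extChartAt I p x) :=
    ((contDiffAt_comp_extChartAt_symm hf p
      ((extChartAt I p).map_source hx)).differentiableAt (by simp)).mdifferentiableAt
  rw [h1.mfderiv_eq, mfderiv_comp x h3 h2, mfderiv_eq_fderiv]
  rfl

variable [FiniteDimensional ℝ E] [SecondCountableTopology M]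

theorem dimH_secants_le (hf : ContMDiff I 𝓘(ℝ, F) ∞ f) :
    dimH (range fun x : M × M => f x.1 - f x.2) ≤ (2 * finrank ℝ E : ℕ) := by
  obtain ⟨s, hs, hsu⟩ := exists_countable_iUnion_extChartAt_source I M
  let φ (p : M × M) (z : E × E) : F :=
    (f ∘ (extChartAt I p.1).symm) z.1 - (f ∘ (extChartAt I p.2).symm) z.2
  have hsub : (range fun x : M × M => f x.1 - f x.2) ⊆
      ⋃ p ∈ s ×ˢ s, φ p '' ((extChartAt I p.1).target ×ˢ (extChartAt I p.2).target) := by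
    rintro _ ⟨⟨x, y⟩, rfl⟩
    obtain ⟨p, hp, hx⟩ := hsu x
    obtain ⟨q, hq, hy⟩ := hsu y
    refine mem_iUnion₂.2 ⟨(p, q), ⟨hp, hq⟩, (extChartAt I p x, extChartAt I q y),
      ⟨(extChartAt I p).map_source hx, (extChartAt I q).map_source hy⟩, ?_⟩
    simp only [φ, Function.comp_apply, (extChartAt I p).left_inv hx,
      (extChartAt I q).left_inv hy]
  refine (dimH_mono hsub).trans ?_
  rw [dimH_bUnion (hs.prod hs)]
  refine iSup₂_le fun p _ => (dimH_image_le_of_contDiffAt fun z hz => ?_).trans (dimH_prod_le _)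
  exact (((contDiffAt_comp_extChartAt_symm hf p.1 hz.1).of_le (by simp)).comp z
    contDiffAt_fst).sub (((contDiffAt_comp_extChartAt_symm hf p.2 hz.2).of_le (by simp)).comp z
    contDiffAt_snd)

theorem dimH_tangents_le (hf : ContMDiff I 𝓘(ℝ, F) ∞ f) :
    dimH {y : F | ∃ (x : M) (w : TangentSpace I x), mfderiv I 𝓘(ℝ, F) f x w = y} ≤
      (2 * finrank ℝ E : ℕ) := by
  obtain ⟨s, hs, hsu⟩ := exists_countable_iUnion_extChartAt_source I M
  let φ (p : M) (z : E × E) : F := fderiv ℝ (f ∘ (extChartAt I p).symm) z.1 z.2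
  have hsub : {y : F | ∃ (x : M) (w : TangentSpace I x), mfderiv I 𝓘(ℝ, F) f x w = y} ⊆
      ⋃ p ∈ s, φ p '' ((extChartAt I p).target ×ˢ univ) := by
    rintro _ ⟨x, w, rfl⟩
    obtain ⟨p, hp, hx⟩ := hsu x
    exact mem_iUnion₂.2 ⟨p, hp, (extChartAt I p x, mfderiv I 𝓘(ℝ, E) (extChartAt I p) x w),
      ⟨(extChartAt I p).map_source hx, mem_univ _⟩,
      (mfderiv_eq_fderiv_comp_mfderiv_extChartAt hf p hx w).symm⟩
  refine (dimH_mono hsub).trans ?_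
  rw [dimH_bUnion hs]
  refine iSup₂_le fun p _ => (dimH_image_le_of_contDiffAt fun z hz => ?_).trans (dimH_prod_le _)
  have h1 : ContDiffAt ℝ 1 (fderiv ℝ (f ∘ (extChartAt I p).symm)) z.1 :=
    (contDiffAt_comp_extChartAt_symm hf p hz.1).fderiv_right (by norm_cast)
  exact (h1.comp z contDiffAt_fst).clm_apply contDiffAt_snd

end Dimension

/-! ### Embeddings near compact sets -/

section Immersion

open Module Set Filter Topology

variable {E : Type*} [NormedAddCommGroup E] [NormedSpace ℝ E]
  {H : Type*} [TopologicalSpace H]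
  {M : Type u} [TopologicalSpace M] [ChartedSpace H M]

/-- `f : M → F` is smooth, and is injective with injective differentials on `K`. -/
structure IsInjImmersionOn (I : ModelWithCorners ℝ E H) {F : Type*} [NormedAddCommGroup F]
    [NormedSpace ℝ F] (f : M → F) (K : Set M) : Prop where
  contMDiff : ContMDiff I 𝓘(ℝ, F) ∞ f
  injOn : InjOn f K
  mfderiv_injective : ∀ x ∈ K, Function.Injective (mfderiv I 𝓘(ℝ, F) f x)

variable {I : ModelWithCorners ℝ E H} {F G : Type*} [NormedAddCommGroup F] [NormedSpace ℝ F]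
  [NormedAddCommGroup G] [NormedSpace ℝ G] {f : M → F} {K : Set M}

theorem mfderiv_clm_comp (hf : ContMDiff I 𝓘(ℝ, F) ∞ f) (L : F →L[ℝ] G) (x : M)
    (w : TangentSpace I x) :
    mfderiv I 𝓘(ℝ, G) (fun y => L (f y)) x w = L (mfderiv I 𝓘(ℝ, F) f x w) := by
  have := L.hasMFDerivAt.comp x (hf.mdifferentiableAt (x := x) (by simp)).hasMFDerivAt
  exact DFunLike.congr_fun this.mfderiv w

/-- A linear map that kills neither secants nor tangents of `f` preserves injective immersions. -/
theorem IsInjImmersionOn.clm_comp (hf : IsInjImmersionOn I f K) (L : F →L[ℝ] G)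
    (h1 : ∀ x ∈ K, ∀ y ∈ K, L (f x - f y) = 0 → f x - f y = 0)
    (h2 : ∀ x ∈ K, ∀ w : TangentSpace I x, L (mfderiv I 𝓘(ℝ, F) f x w) = 0 →
      mfderiv I 𝓘(ℝ, F) f x w = 0) : IsInjImmersionOn I (fun x => L (f x)) K where
  contMDiff := L.contMDiff.comp hf.contMDiff
  injOn x hx y hy hxy := hf.injOn hx hy (sub_eq_zero.1 (h1 x hx y hy (by
    rw [map_sub, sub_eq_zero]
    exact hxy)))
  mfderiv_injective x hx := by
    rw [injective_iff_map_eq_zero]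
    intro w hw
    rw [mfderiv_clm_comp hf.contMDiff] at hw
    exact (injective_iff_map_eq_zero _).1 (hf.mfderiv_injective x hx) w (h2 x hx w hw)

theorem IsInjImmersionOn.clm_comp_of_injective (hf : IsInjImmersionOn I f K) (L : F →L[ℝ] G)
    (hL : Function.Injective L) : IsInjImmersionOn I (fun x => L (f x)) K :=
  hf.clm_comp L (fun _ _ _ _ h => (map_eq_zero_iff L hL).1 h)
    (fun _ _ _ h => (map_eq_zero_iff L hL).1 h)

variable [FiniteDimensional ℝ E] [IsManifold I ∞ M]

/-- Projection along a generic direction: the directions `(v, 1)` of secants and tangents of `f`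
form a set of Hausdorff dimension at most `2 dim M`, so one can project along another one. -/
theorem IsInjImmersionOn.exists_projection [I.Boundaryless] [SecondCountableTopology M]
    [FiniteDimensional ℝ F] (hF : 2 * finrank ℝ E < finrank ℝ F) {f : M → F × ℝ}
    (hf : IsInjImmersionOn I f K) : ∃ g : M → F, IsInjImmersionOn I g K := by
  let Z : Set (F × ℝ) := (range fun x : M × M => f x.1 - f x.2) ∪
    {y | ∃ (x : M) (w : TangentSpace I x), mfderiv I 𝓘(ℝ, F × ℝ) f x w = y}
  have hZ : dimH Z ≤ (2 * finrank ℝ E : ℕ) := by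
    rw [dimH_union]
    exact max_le (dimH_secants_le hf.contMDiff) (dimH_tangents_le hf.contMDiff)
  let B : Set F := (fun z : F × ℝ => z.2⁻¹ • z.1) '' (Z ∩ {z | z.2 ≠ 0})
  have hB : dimH B < finrank ℝ F := by
    refine lt_of_le_of_lt ((dimH_image_le_of_contDiffAt fun z hz => ?_).trans
      ((dimH_mono inter_subset_left).trans hZ)) (by exact_mod_cast hF)
    exact (contDiffAt_snd.inv hz.2).smul contDiffAt_fst
  obtain ⟨v, hv⟩ := (dense_compl_of_dimH_lt_finrank hB).nonempty
  let L : F × ℝ →L[ℝ] F := ContinuousLinearMap.fst ℝ F ℝ -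
    (ContinuousLinearMap.snd ℝ F ℝ).smulRight v
  have hL : ∀ z ∈ Z, L z = 0 → z = 0 := by
    intro z hz hLz
    have h1 : z.1 = z.2 • v := sub_eq_zero.1 hLz
    by_cases h2 : z.2 = 0
    · rw [h2, zero_smul] at h1
      exact Prod.ext h1 h2
    · refine absurd ⟨z, ⟨hz, h2⟩, ?_⟩ hv
      simp only [h1, inv_smul_smul₀ h2]
  exact ⟨_, hf.clm_comp L (fun x _ y _ => hL _ (Or.inl ⟨(x, y), rfl⟩))
    (fun x _ w => hL _ (Or.inr ⟨x, w, rfl⟩))⟩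

/-- Injective immersions near `K` can be taken with values in dimension `2 dim M + 1`. -/
theorem IsInjImmersionOn.exists_euclidean [I.Boundaryless] [SecondCountableTopology M]
    [FiniteDimensional ℝ F] (hf : IsInjImmersionOn I f K) :
    ∃ g : M → Euc (2 * finrank ℝ E + 1), IsInjImmersionOn I g K := by
  have key (k : ℕ) : (∃ g : M → Euc (2 * finrank ℝ E + 1 + k), IsInjImmersionOn I g K) →
      ∃ g : M → Euc (2 * finrank ℝ E + 1), IsInjImmersionOn I g K := by
    induction k with
    | zero => exact id
    | succ k ih =>
      rintro ⟨g, hg⟩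
      refine ih ?_
      let e : Euc (2 * finrank ℝ E + 1 + (k + 1)) ≃L[ℝ] Euc (2 * finrank ℝ E + 1 + k) × ℝ :=
        ContinuousLinearEquiv.ofFinrankEq (by
          rw [finrank_prod, finrank_euclideanSpace_fin, finrank_euclideanSpace_fin, finrank_self]
          rfl)
      exact (hg.clm_comp_of_injective e.toContinuousLinearMap e.injective).exists_projection (by
        rw [finrank_euclideanSpace_fin]
        omega)
  -- adding zero coordinates makes the dimension of the target large enough to start the descent
  have hdim : finrank ℝ (F × Euc (2 * finrank ℝ E + 1)) =
      finrank ℝ (Euc (2 * finrank ℝ E + 1 + finrank ℝ F)) := by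
    rw [finrank_prod, finrank_euclideanSpace_fin, finrank_euclideanSpace_fin, add_comm]
  let e := ContinuousLinearEquiv.ofFinrankEq hdim
  refine key (finrank ℝ F) ⟨_, hf.clm_comp_of_injective
    (e.toContinuousLinearMap.comp
      (ContinuousLinearMap.inl ℝ F (Euc (2 * finrank ℝ E + 1)))) ?_⟩
  exact e.injective.comp fun x y h => congrArg Prod.fst h

/-- Near a compact set, finitely many charts, cut off by bump functions, together with these bump
functions give an injective immersion. -/
theorem exists_isInjImmersionOn_of_isCompact [I.Boundaryless] [SecondCountableTopology M]
    [T2Space M] (hK : IsCompact K) :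
    ∃ g : M → Euc (2 * finrank ℝ E + 1), IsInjImmersionOn I g K := by
  let b (x : M) : SmoothBumpFunction I x := Classical.arbitrary _
  obtain ⟨t, -, ht⟩ := hK.elim_nhds_subcover (fun x => {y | b x =ᶠ[𝓝 y] 1})
    (fun x _ => eventually_eventually_nhds.2 (b x).eventuallyEq_one)
  have ht' : ∀ x ∈ K, ∃ i : t, b i =ᶠ[𝓝 x] 1 := fun x hx => by
    obtain ⟨y, hy, hxy⟩ := mem_iUnion₂.1 (ht hx)
    exact ⟨⟨y, hy⟩, hxy⟩
  let f (x : M) (i : t) : E × ℝ := (b i x • extChartAt I (i : M) x, b i x)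
  have hf : ContMDiff I 𝓘(ℝ, t → E × ℝ) ∞ f := contMDiff_pi_space.2 fun i =>
    ((b i).contMDiff_smul contMDiffOn_extChartAt).prodMk_space (b i).contMDiff
  have hsource {i : t} {x : M} (h : b i x = 1) : x ∈ (extChartAt I (i : M)).source := by
    rw [extChartAt_source]
    exact (b i).support_subset_source (by simp [h])
  refine IsInjImmersionOn.exists_euclidean (f := f) ⟨hf, fun x hx y hy hxy => ?_, fun x hx => ?_⟩
  · obtain ⟨i, hi⟩ := ht' x hx
    have hx1 : b i x = 1 := hi.eq_of_nhds
    have h1 : b i x • extChartAt I (i : M) x = b i y • extChartAt I (i : M) y :=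
      congrArg Prod.fst (congrFun hxy i)
    have h2 : b i x = b i y := congrArg Prod.snd (congrFun hxy i)
    rw [← h2, hx1, one_smul, one_smul] at h1
    exact (extChartAt I (i : M)).injOn (hsource hx1) (hsource (h2.symm.trans hx1)) h1
  · obtain ⟨i, hi⟩ := ht' x hx
    let L : (t → E × ℝ) →L[ℝ] E :=
      (ContinuousLinearMap.fst ℝ E ℝ).comp (ContinuousLinearMap.proj i)
    have h1 : (fun y => L (f y)) =ᶠ[𝓝 x] extChartAt I (i : M) := by
      filter_upwards [hi] with y hy
      change b i y • extChartAt I (i : M) y = _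
      rw [hy, Pi.one_apply, one_smul]
    have h2 := (isInvertible_mfderiv_extChartAt (I := I) (hsource hi.eq_of_nhds)).injective
    intro v w hvw
    apply h2
    rw [← h1.mfderiv_eq]
    exact (mfderiv_clm_comp hf L x v).trans
      ((congrArg L hvw).trans (mfderiv_clm_comp hf L x w).symm)

end Immersion

/-! ### Closed embeddings with local retractions -/

section ClosedEmbedding

open Module Set Filter Topology

variable {E : Type*} [NormedAddCommGroup E] [NormedSpace ℝ E] {H : Type*} [TopologicalSpace H]
  {I : ModelWithCorners ℝ E H} {M : Type u} [TopologicalSpace M] [ChartedSpace H M]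
  {F G : Type*} [NormedAddCommGroup F] [NormedSpace ℝ F]
  [NormedAddCommGroup G] [NormedSpace ℝ G]

/-- The local inverse of a smooth map with invertible differential is smooth near the point. -/
theorem exists_localInverse_contDiffOn [CompleteSpace E] {g : E → E} {s : Set E} (hs : IsOpen s)
    (hg : ContDiffOn ℝ ∞ g s) {z : E} (hz : z ∈ s)
    (hd : fderiv ℝ g z = ContinuousLinearMap.id ℝ E) :
    ∃ (r : E → E) (V : Set E), IsOpen V ∧ g z ∈ V ∧ ContDiffOn ℝ ∞ r V ∧ MapsTo r V s ∧
      ∀ᶠ y in 𝓝 z, r (g y) = y := by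
  have hgz : ContDiffAt ℝ ∞ g z := hg.contDiffAt (hs.mem_nhds hz)
  have hd' : HasFDerivAt g (ContinuousLinearEquiv.refl ℝ E : E →L[ℝ] E) z := by
    have := (hgz.differentiableAt (by simp)).hasFDerivAt
    rw [hd] at this
    exact this
  let e := hgz.toOpenPartialHomeomorph g hd' (by simp)
  have hze : z ∈ e.source := hgz.mem_toOpenPartialHomeomorph_source hd' (by simp)
  let D : Set E := s ∩ fderiv ℝ g ⁻¹' range ((↑) : (E ≃L[ℝ] E) → (E →L[ℝ] E))
  have hD : IsOpen D := (hg.continuousOn_fderiv_of_isOpen hs (by simp)).isOpen_inter_preimage hs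
    (ContinuousLinearEquiv.isOpen)
  have hzD : z ∈ D := ⟨hz, ContinuousLinearEquiv.refl ℝ E, hd.symm⟩
  refine ⟨e.symm, e.target ∩ e.symm ⁻¹' D, e.symm.isOpen_inter_preimage hD,
    ⟨e.map_source hze, ?_⟩, fun y hy => ?_, fun y hy => hy.2.1, ?_⟩
  · change e.symm (e z) ∈ D
    rwa [e.left_inv hze]
  · obtain ⟨L, hL⟩ := hy.2.2
    have h1 : ContDiffAt ℝ ∞ g (e.symm y) := hg.contDiffAt (hs.mem_nhds hy.2.1)
    refine (e.contDiffAt_symm (f₀' := L) hy.1 ?_ h1).contDiffWithinAt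
    rw [hL]
    exact (h1.differentiableAt (by simp)).hasFDerivAt
  · filter_upwards [e.open_source.mem_nhds hze] with y hy
    exact e.left_inv hy

/-- A smooth closed embedding `a` of a manifold in a vector space which has smooth left inverses
near each point of its image. -/
structure IsRetractileEmbedding (I : ModelWithCorners ℝ E H) (a : M → F) : Prop where
  contMDiff : ContMDiff I 𝓘(ℝ, F) ∞ a
  isClosedEmbedding : IsClosedEmbedding a
  exists_retraction : ∀ x : M, ∃ (r : F → M), ∃ V ∈ 𝓝 (a x), ContMDiffOn 𝓘(ℝ, F) I ∞ r V ∧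
    ∀ y : M, a y ∈ V → r (a y) = y

/-- Smooth functions on a product of closed submanifolds extend to the ambient space. -/
theorem IsRetractileEmbedding.exists_extension_prod [FiniteDimensional ℝ F]
    [FiniteDimensional ℝ G] {E' : Type*} [NormedAddCommGroup E'] [NormedSpace ℝ E']
    {H' : Type*} [TopologicalSpace H'] {J : ModelWithCorners ℝ E' H'} {N : Type v}
    [TopologicalSpace N] [ChartedSpace H' N] {a : M → F} {b : N → G}
    (ha : IsRetractileEmbedding I a) (hb : IsRetractileEmbedding J b)
    (f : Cinf (I.prod J) (M × N)) :
    ∃ g : F × G → ℝ, ContDiff ℝ ∞ g ∧ ∀ x y, g (a x, b y) = f (x, y) := by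
  obtain ⟨g, hg⟩ := exists_contMDiffMap_forall_mem_convex_of_local (n := ⊤) 𝓘(ℝ, F × G)
    (t := fun z : F × G => {v : ℝ | ∀ x y, (a x, b y) = z → v = f (x, y)})
    (fun z v hv w hw s t _ _ hst x y hxy => by
      rw [hv x y hxy, hw x y hxy, ← add_smul, hst, one_smul])
    (fun z => by
      by_cases hz : z ∈ range (Prod.map a b)
      · obtain ⟨⟨x, y⟩, rfl⟩ := hz
        obtain ⟨r, V, hV, hr, hra⟩ := ha.exists_retraction x
        obtain ⟨s, W, hW, hs, hsb⟩ := hb.exists_retraction y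
        refine ⟨V ×ˢ W, prod_mem_nhds hV hW, fun z => f (r z.1, s z.2), ?_, ?_⟩
        · exact f.contMDiff.comp_contMDiffOn
            ((hr.comp contDiff_fst.contMDiff.contMDiffOn fun (z : F × G) (hz : z ∈ V ×ˢ W) =>
              hz.1).prodMk
              (hs.comp contDiff_snd.contMDiff.contMDiffOn fun (z : F × G) (hz : z ∈ V ×ˢ W) =>
                hz.2))
        · rintro _ hz x' y' rfl
          simp only [hra x' hz.1, hsb y' hz.2]
      · refine ⟨(range (Prod.map a b))ᶜ, (ha.isClosedEmbedding.prodMap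
          hb.isClosedEmbedding).isClosed_range.isOpen_compl.mem_nhds hz, fun _ => 0,
          contMDiffOn_const, ?_⟩
        rintro _ hz x' y' rfl
        exact absurd ⟨(x', y'), rfl⟩ hz)
  refine ⟨g, ?_, fun x y => hg (a x, b y) x y rfl⟩
  exact g.contMDiff.contDiff

variable [FiniteDimensional ℝ E] [IsManifold I ∞ M]

/-- Smooth functions given on disjoint closed slabs of a smooth function `h`, which are a fixed
distance apart, extend to a common smooth function. -/
theorem exists_contMDiff_eq_on_slabs [T2Space M] [SecondCountableTopology M]
    [FiniteDimensional ℝ F] {h : M → ℝ} (hh : Continuous h) {f : ℤ → M → F}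
    (hf : ∀ k, ContMDiff I 𝓘(ℝ, F) ∞ (f k)) :
    ∃ g : M → F, ContMDiff I 𝓘(ℝ, F) ∞ g ∧
      ∀ (k : ℤ) (x : M), h x ∈ Icc (2 * k - 8⁻¹ : ℝ) (2 * k + 9 / 8) → g x = f k x := by
  have := sigmaCompactSpace_of_chartedSpace I M
  obtain ⟨g, hg⟩ := exists_contMDiffMap_forall_mem_convex_of_local (n := ⊤) I
    (t := fun x => {v : F | ∀ k : ℤ, h x ∈ Icc (2 * k - 8⁻¹ : ℝ) (2 * k + 9 / 8) → v = f k x})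
    (fun x v hv w hw s t _ _ hst k hk => by
      rw [hv k hk, hw k hk, ← add_smul, hst, one_smul])
    (fun x => by
      -- the slab nearest to `x` is the only one that meets a neighbourhood of `x`
      let k : ℤ := ⌊(h x + 1 / 2) / 2⌋
      have h1 : (k : ℝ) ≤ (h x + 1 / 2) / 2 := Int.floor_le _
      have h2 : (h x + 1 / 2) / 2 < k + 1 := Int.lt_floor_add_one _
      refine ⟨h ⁻¹' Ioo (2 * k - 5 / 8) (2 * k + 3 / 2), hh.continuousAt.preimage_mem_nhds
        (Ioo_mem_nhds (by linarith) (by linarith)), f k, (hf k).contMDiffOn, fun y hy j hj => ?_⟩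
      have h3 : (j : ℝ) < k + 1 := by linarith [hy.2, hj.1]
      have h4 : (k : ℝ) < j + 1 := by linarith [hy.1, hj.2]
      have h5 : j < k + 1 := by exact_mod_cast h3
      have h6 : k < j + 1 := by exact_mod_cast h4
      rw [show j = k by omega])
  exact ⟨g, g.contMDiff, fun k x hk => hg x k hk⟩

variable [I.Boundaryless]

/-- A closed embedding with injective differentials has local retractions, by the inverse function
theorem applied to the composition with a linear left inverse of the differential. -/
theorem isRetractileEmbedding_of_mfderiv_injective [FiniteDimensional ℝ F] {a : M → F}
    (ha : ContMDiff I 𝓘(ℝ, F) ∞ a) (hemb : IsClosedEmbedding a)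
    (hinj : ∀ x, Function.Injective (mfderiv I 𝓘(ℝ, F) a x)) : IsRetractileEmbedding I a := by
  refine ⟨ha, hemb, fun x => ?_⟩
  let φ := extChartAt I x
  let b : E → F := a ∘ φ.symm
  let z : E := φ x
  have hb {y : E} (hy : y ∈ φ.target) : ContDiffAt ℝ ∞ b y :=
    contDiffAt_comp_extChartAt_symm ha x hy
  have hz : z ∈ φ.target := mem_extChartAt_target x
  have hbinj : Function.Injective (fderiv ℝ b z) := by
    rw [injective_iff_map_eq_zero]
    intro w hw
    obtain ⟨v, rfl⟩ := (isInvertible_mfderiv_extChartAt (I := I)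
      (mem_extChartAt_source (I := I) x)).surjective w
    have h1 := mfderiv_eq_fderiv_comp_mfderiv_extChartAt ha x (mem_extChartAt_source x) v
    have h2 : v = 0 := (injective_iff_map_eq_zero _).1 (hinj x) v (h1.trans hw)
    exact (congrArg (mfderiv I 𝓘(ℝ, E) (extChartAt I x) x) h2).trans (map_zero _)
  obtain ⟨L, hL⟩ := (fderiv ℝ b z : E →ₗ[ℝ] F).exists_leftInverse_of_injective
    (LinearMap.ker_eq_bot.2 hbinj)
  let L' : F →L[ℝ] E := LinearMap.toContinuousLinearMap L
  have hd : fderiv ℝ (fun y => L' (b y)) z = ContinuousLinearMap.id ℝ E := by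
    have h1 := (L'.hasFDerivAt.comp z ((hb hz).differentiableAt (by simp)).hasFDerivAt).fderiv
    refine h1.trans (ContinuousLinearMap.ext fun w => ?_)
    exact LinearMap.congr_fun hL w
  obtain ⟨r, V, hV, hzV, hr, hrV, hrg⟩ := exists_localInverse_contDiffOn
    (isOpen_extChartAt_target x) (fun y hy => (L'.contDiff.contDiffAt.comp y
      (hb hy)).contDiffWithinAt) hz hd
  have hax : b z = a x := congrArg a (extChartAt_to_inv (I := I) x)
  have h1 : ∀ᶠ y in 𝓝 x, φ.symm (r (L' (a y))) = y := by
    have h2 := (continuousAt_extChartAt (I := I) x).eventually hrg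
    filter_upwards [h2, extChartAt_source_mem_nhds (I := I) x] with y hy hyx
    have h3 : b (φ y) = a y := congrArg a (φ.left_inv hyx)
    change r (L' (b (φ y))) = φ y at hy
    rw [← h3, hy, φ.left_inv hyx]
  rw [hemb.isInducing.nhds_eq_comap, eventually_comap] at h1
  change L' (b z) ∈ V at hzV
  rw [hax] at hzV
  refine ⟨fun w => φ.symm (r (L' w)), L' ⁻¹' V ∩ {w | ∀ y, a y = w → φ.symm (r (L' (a y))) = y},
    inter_mem (L'.continuous.continuousAt.preimage_mem_nhds (hV.mem_nhds hzV)) h1, ?_,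
    fun y hy => hy.2 y rfl⟩
  exact (contMDiffOn_extChartAt_symm x).comp ((hr.contMDiffOn.comp
    L'.contMDiff.contMDiffOn fun w hw => hw.1)) fun w hw => hrV hw.1

/-- Injective immersions of all the slabs `h⁻¹[k, k + 1]` of a smooth exhaustion function `h` in one
vector space give a closed embedding: those with `k` even, and those with `k` odd, are joined to one
function each, and `h` itself is added as a coordinate. -/
theorem exists_isRetractileEmbedding_of_slabs [T2Space M] [SecondCountableTopology M]
    [FiniteDimensional ℝ G] (h : Cinf I M)
    (hh : ∀ c : ℝ, IsCompact {x | h x ≤ c}) {f : ℤ → M → G}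
    (hf : ∀ k : ℤ, IsInjImmersionOn I (f k) (h ⁻¹' Icc (k : ℝ) (k + 1))) :
    ∃ (k : ℕ) (a : M → Euc k), IsRetractileEmbedding I a := by
  have hcont : Continuous h := h.contMDiff.continuous
  obtain ⟨g₀, hg₀, hgf₀⟩ := exists_contMDiff_eq_on_slabs hcont
    fun k => (hf (2 * k)).contMDiff
  obtain ⟨g₁, hg₁, hgf₁⟩ := exists_contMDiff_eq_on_slabs (h := fun x => h x - 1)
    (hcont.sub continuous_const) fun k => (hf (2 * k + 1)).contMDiff
  let b (x : M) : ℝ × G × G := (h x, g₀ x, g₁ x)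
  have hb : ContMDiff I 𝓘(ℝ, ℝ × G × G) ∞ b := h.contMDiff.prodMk_space (hg₀.prodMk_space hg₁)
  have key (k : ℤ) : ∃ P : ℝ × G × G →L[ℝ] G,
      ∀ x, h x ∈ Ioo (k - 8⁻¹ : ℝ) (k + 9 / 8) → P (b x) = f k x := by
    obtain ⟨j, rfl | rfl⟩ := Int.even_or_odd' k
    · refine ⟨(ContinuousLinearMap.fst ℝ G G).comp (ContinuousLinearMap.snd ℝ ℝ (G × G)),
        fun x hx => hgf₀ j x ?_⟩
      push_cast at hx
      exact ⟨hx.1.le, hx.2.le⟩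
    · refine ⟨(ContinuousLinearMap.snd ℝ G G).comp (ContinuousLinearMap.snd ℝ ℝ (G × G)),
        fun x hx => hgf₁ j x ?_⟩
      push_cast at hx
      exact ⟨by linarith [hx.1], by linarith [hx.2]⟩
  have hbinj : Function.Injective b := by
    intro x y hxy
    obtain ⟨P, hP⟩ := key ⌊h x⌋
    have h1 : h x = h y := congrArg Prod.fst hxy
    have h2 : h x ∈ Icc (⌊h x⌋ : ℝ) (⌊h x⌋ + 1) :=
      ⟨Int.floor_le _, (Int.lt_floor_add_one _).le⟩
    have h3 : h x ∈ Ioo (⌊h x⌋ - 8⁻¹ : ℝ) (⌊h x⌋ + 9 / 8) :=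
      ⟨by linarith [h2.1], by linarith [h2.2]⟩
    refine (hf ⌊h x⌋).injOn h2 (by rwa [mem_preimage, ← h1]) ?_
    rw [← hP x h3, ← hP y (h1 ▸ h3), hxy]
  have hbder (x : M) : Function.Injective (mfderiv I 𝓘(ℝ, ℝ × G × G) b x) := by
    obtain ⟨P, hP⟩ := key ⌊h x⌋
    have h2 : h x ∈ Icc (⌊h x⌋ : ℝ) (⌊h x⌋ + 1) :=
      ⟨Int.floor_le _, (Int.lt_floor_add_one _).le⟩
    have h3 : (fun y => P (b y)) =ᶠ[𝓝 x] f ⌊h x⌋ := by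
      filter_upwards [hcont.continuousAt.preimage_mem_nhds (Ioo_mem_nhds
        (show ⌊h x⌋ - 8⁻¹ < h x by linarith [h2.1])
        (show h x < ⌊h x⌋ + 9 / 8 by linarith [h2.2]))] with y hy
      exact hP y hy
    have h4 := (hf ⌊h x⌋).mfderiv_injective x h2
    rw [← h3.mfderiv_eq] at h4
    intro v w hvw
    exact h4 ((mfderiv_clm_comp hb P x v).trans
      ((congrArg P hvw).trans (mfderiv_clm_comp hb P x w).symm))
  have hbclosed : IsClosedEmbedding b := by
    refine .of_continuous_injective_isClosedMap hb.continuous hbinj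
      (isProperMap_iff_isCompact_preimage.2 ⟨hb.continuous, fun C hC => ?_⟩).isClosedMap
    obtain ⟨c, hc⟩ := (hC.image continuous_fst).bddAbove
    exact (hh c).of_isClosed_subset (hC.isClosed.preimage hb.continuous)
      fun x hx => hc ⟨b x, hx, rfl⟩
  have hdim : finrank ℝ (ℝ × G × G) = finrank ℝ (Euc (finrank ℝ (ℝ × G × G))) :=
    finrank_euclideanSpace_fin.symm
  let e := ContinuousLinearEquiv.ofFinrankEq hdim
  refine ⟨_, fun x => e (b x), isRetractileEmbedding_of_mfderiv_injective
    (e.contDiff.contMDiff.comp hb) (e.toHomeomorph.isClosedEmbedding.comp hbclosed) fun x => ?_⟩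
  intro v w hvw
  exact hbder x (e.injective ((mfderiv_clm_comp hb e.toContinuousLinearMap x v).symm.trans
    (hvw.trans (mfderiv_clm_comp hb e.toContinuousLinearMap x w))))

/-- The weak Whitney embedding theorem, for manifolds which need not be compact. -/
theorem exists_isRetractileEmbedding (I : ModelWithCorners ℝ E H) [I.Boundaryless] (M : Type u)
    [TopologicalSpace M] [ChartedSpace H M] [IsManifold I ∞ M] [T2Space M]
    [SecondCountableTopology M] :
    ∃ (k : ℕ) (a : M → Euc k), IsRetractileEmbedding I a := by
  obtain ⟨h, hh⟩ := exists_contMDiffMap_isCompact_sublevel (I := I) (M := M)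
  choose f hf using fun k : ℤ => exists_isInjImmersionOn_of_isCompact (I := I)
    (K := h ⁻¹' Icc (k : ℝ) (k + 1)) ((hh (k + 1)).of_isClosed_subset
      (isClosed_Icc.preimage h.contMDiff.continuous) fun x hx => hx.2)
  exact exists_isRetractileEmbedding_of_slabs h hh hf

end ClosedEmbedding

/-! ### The coproduct of `C^∞(M)` and `C^∞(N)` -/

section Product

variable {E : Type*} [NormedAddCommGroup E] [NormedSpace ℝ E] [FiniteDimensional ℝ E]
  {H : Type*} [TopologicalSpace H] {I : ModelWithCorners ℝ E H} [I.Boundaryless]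
  {M : Type u} [TopologicalSpace M] [ChartedSpace H M] [IsManifold I ∞ M] [T2Space M]
  [SecondCountableTopology M]
  {E' : Type*} [NormedAddCommGroup E'] [NormedSpace ℝ E'] [FiniteDimensional ℝ E']
  {H' : Type*} [TopologicalSpace H'] {J : ModelWithCorners ℝ E' H'} [J.Boundaryless]
  {N : Type v} [TopologicalSpace N] [ChartedSpace H' N] [IsManifold J ∞ N] [T2Space N]
  [SecondCountableTopology N]

/-- Every smooth function on `M × N` is a smooth function of finitely many smooth functions on `M`
and finitely many smooth functions on `N`. -/
theorem exists_eq_comp_append (f : Cinf (I.prod J) (M × N)) :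
    ∃ (k l : ℕ) (a : Fin k → Cinf I M) (b : Fin l → Cinf J N) (g : CinfEuc (k + l)),
      ∀ x y, f (x, y) = g (WithLp.toLp 2 (Fin.append (fun i => a i x) fun j => b j y)) := by
  obtain ⟨k, a, ha⟩ := exists_isRetractileEmbedding I M
  obtain ⟨l, b, hb⟩ := exists_isRetractileEmbedding J N
  obtain ⟨g, hg, hgf⟩ := ha.exists_extension_prod hb f
  have hproj : ContDiff ℝ ∞ fun z : Euc (k + l) => (projLeft k l z, projRight k l z) :=
    (projLeft k l).contMDiff.contDiff.prodMk (projRight k l).contMDiff.contDiff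
  refine ⟨k, l, fun i => ⟨fun x => a x i, (coord k i).contMDiff.comp ha.contMDiff⟩,
    fun j => ⟨fun y => b y j, (coord l j).contMDiff.comp hb.contMDiff⟩,
    ⟨_, (hg.comp hproj).contMDiff⟩, fun x y => ?_⟩
  rw [← hgf]
  refine congrArg g (Prod.ext ?_ ?_)
  · ext i
    exact (Fin.append_left (fun i => a x i) (fun j => b y j) i).symm
  · ext j
    exact (Fin.append_right (fun i => a x i) (fun j => b y j) j).symm

theorem IsSmoothlyClosedGeometric.existsUnique_algHom_prod {A : Type w} [CommRing A] [Algebra ℝ A]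
    (hA : IsSmoothlyClosedGeometric A) (φ : Cinf I M →ₐ[ℝ] A) (ψ : Cinf J N →ₐ[ℝ] A) :
    ∃! χ : Cinf (I.prod J) (M × N) →ₐ[ℝ] A,
      χ.comp (pullback (ContMDiffMap.fst : C^∞⟮I.prod J, M × N; I, M⟯)) = φ ∧
      χ.comp (pullback (ContMDiffMap.snd : C^∞⟮I.prod J, M × N; J, N⟯)) = ψ := by
  choose p hp using fun x : RealSpec A => exists_eq_pointEval (x.comp φ)
  choose q hq using fun x : RealSpec A => exists_eq_pointEval (x.comp ψ)
  obtain ⟨χ, hχ⟩ := hA.exists_algHom_of_ev (fun x => pointEval (I.prod J) (p x, q x)) (by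
    intro f
    obtain ⟨k, l, a, b, g, hg⟩ := exists_eq_comp_append f
    obtain ⟨c, hc, -⟩ := hA (k + l) (Fin.append (fun i => φ (a i)) fun j => ψ (b j)) g
    refine ⟨c, fun x => (congrFun hc x).symm.trans ?_⟩
    rw [pointEval_apply, hg]
    congr 2
    funext i
    induction i using Fin.addCases with
    | left i =>
      rw [Fin.append_left, Fin.append_left]
      exact DFunLike.congr_fun (hp x) (a i)
    | right j =>
      rw [Fin.append_right, Fin.append_right]
      exact DFunLike.congr_fun (hq x) (b j))
  refine ⟨χ, ⟨hA.algHom_ext fun x => ?_, hA.algHom_ext fun x => ?_⟩, ?_⟩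
  · rw [← AlgHom.comp_assoc, hχ, hp]
    rfl
  · rw [← AlgHom.comp_assoc, hχ, hq]
    rfl
  · rintro χ' ⟨rfl, rfl⟩
    refine hA.algHom_ext fun x => ?_
    rw [hχ]
    obtain ⟨⟨y, z⟩, hyz⟩ := exists_eq_pointEval (x.comp χ')
    have hy : y = p x := pointEval_injective (I := I) (by
      rw [← hp x, ← AlgHom.comp_assoc, hyz]
      rfl)
    have hz : z = q x := pointEval_injective (I := J) (by
      rw [← hq x, ← AlgHom.comp_assoc, hyz]
      rfl)
    rw [hyz, hy, hz]

end Product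

end SmoothAlgebra

end

theorem mainTheorem1 :
    -- smoothly closed geometric algebras are smoothly affine
    (∀ (A : Type u) [CommRing A] [Algebra ℝ A],
      IsSmoothlyClosedGeometric A → IsSmoothlyAffine A) ∧
    -- `C^∞(ℝ^{p+q})` is the coproduct of `C^∞(ℝ^p)` and `C^∞(ℝ^q)` in `Alg_sa`
    (∀ p q : ℕ, ∃ (hp : smoothlyAffine (CommAlgCat.of ℝ (CinfEuc p)))
      (hq : smoothlyAffine (CommAlgCat.of ℝ (CinfEuc q)))
      (hpq : smoothlyAffine (CommAlgCat.of ℝ (CinfEuc (p + q)))),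
      Nonempty (IsColimit (BinaryCofan.mk (C := AlgSA.{0}) (P := ⟨_, hpq⟩)
        (ObjectProperty.homMk (CommAlgCat.ofHom (pullback (projLeft p q))) :
          (⟨_, hp⟩ : AlgSA.{0}) ⟶ ⟨_, hpq⟩)
        (ObjectProperty.homMk (CommAlgCat.ofHom (pullback (projRight p q))) :
          (⟨_, hq⟩ : AlgSA.{0}) ⟶ ⟨_, hpq⟩)))) ∧
    -- `C^∞(U)` is smoothly closed geometric for `U` open in `ℝⁿ`
    (∀ (n : ℕ) (U : Opens (Euc n)), IsSmoothlyClosedGeometric (Cinf (𝓡 n) U)) ∧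
    -- `C^∞` is fully faithful on `Open_{C^∞}` and gives an equivalence of sites
    (∃ h : ∀ U : OpenCinfᵒᵖ, smoothlyAffine (cinfFunctor.obj U),
      (smoothlyAffine.lift cinfFunctor h).Full ∧
      (smoothlyAffine.lift cinfFunctor h).Faithful ∧
      IsSiteEquivalence openTopology
        (zariskiTopology ((smoothlyAffine.lift cinfFunctor h).essImage.ι ⋙ smoothlyAffine.ι))
        (smoothlyAffine.lift cinfFunctor h).toEssImage.rightOp) ∧
    -- `C^∞(X)` is smoothly closed geometric for `X` a smooth manifold
    (∀ (n : ℕ) (X : Type u) [TopologicalSpace X] [T2Space X] [SecondCountableTopology X]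
      [ChartedSpace (Euc n) X] [IsManifold (𝓡 n) ∞ X],
      IsSmoothlyClosedGeometric (Cinf (𝓡 n) X)) ∧
    -- `C^∞(M × N)` is the coproduct of `C^∞(M)` and `C^∞(N)` in `Alg_scg`
    (∀ (m n : ℕ) (M N : Type u)
      [TopologicalSpace M] [T2Space M] [SecondCountableTopology M]
      [ChartedSpace (Euc m) M] [IsManifold (𝓡 m) ∞ M]
      [TopologicalSpace N] [T2Space N] [SecondCountableTopology N]
      [ChartedSpace (Euc n) N] [IsManifold (𝓡 n) ∞ N],
      ∃ (hM : smoothlyClosedGeometric (CommAlgCat.of ℝ (Cinf (𝓡 m) M)))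
        (hN : smoothlyClosedGeometric (CommAlgCat.of ℝ (Cinf (𝓡 n) N)))
        (hMN : smoothlyClosedGeometric
          (CommAlgCat.of ℝ (Cinf ((𝓡 m).prod (𝓡 n)) (M × N)))),
        Nonempty (IsColimit (BinaryCofan.mk (C := AlgSCG.{u}) (P := ⟨_, hMN⟩)
          (ObjectProperty.homMk (CommAlgCat.ofHom
            (pullback (ContMDiffMap.fst : C^∞⟮(𝓡 m).prod (𝓡 n), M × N; 𝓡 m, M⟯))) :
            (⟨_, hM⟩ : AlgSCG.{u}) ⟶ ⟨_, hMN⟩)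
          (ObjectProperty.homMk (CommAlgCat.ofHom
            (pullback (ContMDiffMap.snd : C^∞⟮(𝓡 m).prod (𝓡 n), M × N; 𝓡 n, N⟯))) :
            (⟨_, hN⟩ : AlgSCG.{u}) ⟶ ⟨_, hMN⟩)))) ∧
    -- the forgetful functor `Alg_scg ⥤ Alg_ℝ` has a left adjoint
    (smoothlyClosedGeometric.{u}.ι : AlgSCG.{u} ⥤ CommAlgCat.{u} ℝ).IsRightAdjoint := by
  refine ⟨fun A _ _ hA => hA.isSmoothlyAffine, fun p q => ?_,
    fun n U => isSmoothlyClosedGeometric_cinf (𝓡 n) U,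
    ⟨smoothlyAffine_cinfFunctor, inferInstance, inferInstance, isSiteEquivalence_cinfSite⟩,
    fun n X _ _ _ _ _ => isSmoothlyClosedGeometric_cinf (𝓡 n) X, ?_,
    isRightAdjoint_smoothlyClosedGeometric_ι⟩
  · exact ⟨smoothlyAffine_cinfEuc p, smoothlyAffine_cinfEuc q, smoothlyAffine_cinfEuc (p + q),
      nonempty_isColimit_binaryCofan _ _ fun D φ ψ =>
        IsSmoothlyAffine.existsUnique_algHom_cinfEuc_add D.property φ ψ⟩
  · intro m n M N _ _ _ _ _ _ _ _ _ _
    exact ⟨isSmoothlyClosedGeometric_cinf (𝓡 m) M, isSmoothlyClosedGeometric_cinf (𝓡 n) N,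
      isSmoothlyClosedGeometric_cinf ((𝓡 m).prod (𝓡 n)) (M × N),
      nonempty_isColimit_binaryCofan _ _ fun D φ ψ =>
        IsSmoothlyClosedGeometric.existsUnique_algHom_prod D.property φ ψ⟩
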